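/- **Setting.** Let $M\ge 1$ be an integer, let $\log^* M$ be the least $k$ such that $k$ applications of $\log_2$ to $M$ give a value at most $1$, and put $\Delta_L=\log^*M+6$, $\Delta_R=4$. Let $f:[0..M]^{\log^*M+11}\to\{0,1\}$ be a locally consistent parsing function: for every sequence $p$ over $[1..M]$ of length $n\ge 2$ with $p[i]\ne p[i+1]$ for all $i$, the bits $d[i]=f(\tilde p[i-\Delta_L],\dots,\tilde p[i+\Delta_R])$ (where $\tilde p$ is $p$ extended by zeros) satisfy $d[1]=1$, $d[n]=0$, $d[i]+d[i+1]\le 1$ for $1\le i<n$, and $d[i]+d[i+1]+d[i+2]+d[i+3]\ge 1$ for $1\le i<n-3$. Let $\mathrm{Eblock}_d(p)$ be the decomposition of $p$ into blocks that begin exactly at the positions with $d[i]=1$, and let $\mathrm{Epow}(s)$ be the sequence of maximal runs $a^k$ of $s$. A run-length straight-line program $\mathcal G=(\Sigma,\mathcal V,\mathcal D,S)$ has a finite set $\mathcal V$ of positive integers as variables and exactly one assignment for each variable, of the form $X\to a$ with $a\in\Sigma$, $X\to X_\ell X_r$ or $X\to \hat X^k$ with $k\ge1$; it is acyclic, no two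 variables have the same right-hand side, and every variable occurs in the derivation tree of $S$. Let $\mathrm{val}(X)$ be the string derived by $X$. For a right-hand side $x$, $\mathrm{Sig}(x)$ is the variable to which $x$ is assigned; for blocks $x$ of three or four variables, $\mathrm{Sig}(x)=\mathrm{Sig}(\mathrm{Sig}(x[1..|x|-1])\,x[|x|])$; otherwise it is undefined. $\mathrm{Sig}^+$ applies $\mathrm{Sig}$ entrywise. For a non-empty string $T$ with $4|T|\le M$, $\mathcal G$ is the *signature encoding* of $T$ if $\mathcal V\subseteq[1..M]$ and, with $$\mathrm{Shrink}_0=\mathrm{Sig}^+(T),\quad \mathrm{Pow}_t=\mathrm{Sig}^+(\mathrm{Epow}(\mathrm{Shrink}_t)),\quad \mathrm{Shrink}_{t+1}=\mathrm{Sig}^+(\mathrm{Eblock}_d(\mathrm{Pow}_t)),$$ all signatures needed up to $\mathrm{Pow}_h$ are defined and $\mathrm{Pow}_h=S$, where $h$ is the least $t$ with $|\mathrm{Pow}_t|=1$. A node of a derivation tree has level $t$ if its signature is produced by $\mathrm{Shrink}_t$ or $\mathrm{Pow}_t$ (including the signatures of proper prefixes of blocks). For a string $P$ let $\mathrm{XShrink}_0=\mathrm{Sig}^+(P)$.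 Let $\mathrm{XPow}_t$ be $\mathrm{Sig}^+\circ\mathrm{Epow}$ of $\mathrm{XShrink}_t$ without its first run $\hat L_t$ and its last run $\hat R_t$. With $d$ the bit sequence of $\mathrm{XPow}_t$, let $L_t$ be its shortest prefix of length at least $\Delta_L$ with $d[|L_t|+1]=1$ and $R_t$ its shortest suffix of length at least $\Delta_R+1$ with $d[|d|-|R_t|+1]=1$; let $\mathrm{XShrink}_{t+1}$ be $\mathrm{Sig}^+$ of the blocks of $\mathrm{XPow}_t$ that lie between $L_t$ and $R_t$. Let $h^P$ be the least $t$ with $|\mathrm{Epow}(\mathrm{XShrink}_t)|\le\Delta_L+\Delta_R+9$. The *common sequence* of $P$ is $$\mathrm{Uniq}(P)=\hat L_0L_0\cdots\hat L_{h^P-1}L_{h^P-1}\,\mathrm{XShrink}_{h^P}\,R_{h^P-1}\hat R_{h^P-1}\cdots R_0\hat R_0 .$$ **Lemma.** There is an absolute constant $C>0$ such that the following holds for all $M$, $f$, all alphabets $\Sigma$, all non-empty strings $T$ with $4|T|\le M$ and every signature encoding $\mathcal G$ of $T$. Let $e\in\mathcal V$, let $\mathcal T$ be the derivation tree of $e$,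 let $s=\mathrm{val}(e)$, and let $P$ be a non-empty string with an occurrence in $s$. Then $\mathrm{Uniq}(P)$ is defined and the occurrence is represented by it in $\mathcal T$: $\mathrm{Uniq}(P)$ derives $P$, and each of its entries is the label of a node of $\mathcal T$ that derives the corresponding part of the occurrence. Let $X$ be the subtree of $\mathcal T$ induced by the paths from the root of $\mathcal T$ to the parents of the nodes representing $\mathrm{Uniq}(P)$. Then $X$ has at most $C\log^*M$ nodes in every level, and, if $|s|\ge 2$, at most $C\,(\log_2|s|+\log_2|P|\cdot\log^*M)$ nodes in total. -/

import Mathlib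

namespace SigEnc

/-! ### Locally consistent parsing -/

/-- The iterated logarithm `log* n`: the least number of applications of `log₂` to `n` after
which the value is at most `1`. -/
noncomputable def logStar (n : ℕ) : ℕ :=
  sInf {k : ℕ | (Real.logb 2)^[k] (n : ℝ) ≤ 1}

/-- `Δ_L = log* W + 6`. -/
noncomputable def deltaL (W : ℕ) : ℕ := logStar W + 6

/-- `Δ_R = 4`. -/
def deltaR : ℕ := 4

/-- The bit `d[i] = f(p̃[i - Δ_L], …, p̃[i + Δ_R])` of the sequence `p`, where `p̃` extends `p` by
zeros on both sides. Positions are counted from `0`. -/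
noncomputable def bit {W : ℕ} (f : (Fin (logStar W + 11) → ℕ) → Bool) (p : List ℕ) (i : ℕ) :
    Bool :=
  f fun j => if deltaL W ≤ i + j.val then p.getD (i + j.val - deltaL W) 0 else 0

/-- `f` is a locally consistent parsing function for `[0..W]`: on every sequence `p` over `[1..W]`
of length `n ≥ 2` without equal neighbours, its bit sequence `d` satisfies `d[1] = 1`, `d[n] = 0`,
`d[i] + d[i+1] ≤ 1` for `1 ≤ i < n`, and `d[i] + d[i+1] + d[i+2] + d[i+3] ≥ 1` for `1 ≤ i < n - 3`
(positions in this comment are counted from `1`, in the code from `0`). -/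
def IsLocallyConsistent (W : ℕ) (f : (Fin (logStar W + 11) → ℕ) → Bool) : Prop :=
  ∀ p : List ℕ, 2 ≤ p.length → (∀ x ∈ p, 1 ≤ x ∧ x ≤ W) → p.IsChain (· ≠ ·) →
    bit f p 0 = true ∧
    bit f p (p.length - 1) = false ∧
    (∀ i, i + 1 < p.length → ¬ (bit f p i = true ∧ bit f p (i + 1) = true)) ∧
    (∀ i, i + 4 < p.length →
      bit f p i = true ∨ bit f p (i + 1) = true ∨ bit f p (i + 2) = true ∨ bit f p (i + 3) = true)

/-- Each entry of `p` together with its bit. -/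
noncomputable def withBits {W : ℕ} (f : (Fin (logStar W + 11) → ℕ) → Bool) (p : List ℕ) :
    List (ℕ × Bool) :=
  p.zip ((List.range p.length).map (bit f p))

/-- Cut a sequence into blocks: a new block starts at the first entry and at every entry whose bit
is `1`. -/
def cut : List (ℕ × Bool) → List (List ℕ)
  | [] => []
  | [(x, _)] => [[x]]
  | (x, _) :: (y, b) :: l =>
    if b then [x] :: cut ((y, b) :: l)
    else match cut ((y, b) :: l) with
      | [] => [[x]]
      | q :: qs => (x :: q) :: qs

/-- `Eblock_d(p)`, with the bit sequence `d` that `f` gives for `p`. -/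
noncomputable def eblock {W : ℕ} (f : (Fin (logStar W + 11) → ℕ) → Bool) (p : List ℕ) :
    List (List ℕ) :=
  cut (withBits f p)

/-- `Epow(s)`: the maximal runs `a ^ k` of `s`, as pairs `(a, k)`. -/
def epow : List ℕ → List (ℕ × ℕ)
  | [] => []
  | a :: s =>
    match epow s with
    | [] => [(a, 1)]
    | (b, k) :: r => if a = b then (b, k + 1) :: r else (a, 1) :: (b, k) :: r

/-! ### Run-length straight-line programs and derivation trees -/

/-- The right-hand sides of assignments: a character `a`, a pair `X_ℓ X_r`, or a run `X ^ k`. -/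
inductive Rhs (α : Type*) where
  | char (a : α)
  | pair (l r : ℕ)
  | pow (x k : ℕ)

/-- The variables on the right-hand side, in order; `none` stands for "no assignment". -/
def childrenOf {α : Type*} : Option (Rhs α) → List ℕ
  | none => []
  | some (.char _) => []
  | some (.pair l r) => [l, r]
  | some (.pow x k) => List.replicate k x

/-- A run-length straight-line program. Variables are positive integers; `rhs X` is the right-hand
side assigned to `X`, and `rhs X = none` when `X` is not a variable. -/
structure RLSLP (α : Type*) where
  rhs : ℕ → Option (Rhs α)
  start : ℕ
  finite_vars : {X | rhs X ≠ none}.Finite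
  var_pos : ∀ X, rhs X ≠ none → 1 ≤ X
  start_var : rhs start ≠ none
  closed : ∀ X, ∀ Y ∈ childrenOf (rhs X), rhs Y ≠ none
  exponent_pos : ∀ X x k, rhs X = some (.pow x k) → 1 ≤ k
  acyclic : WellFounded fun Y X => Y ∈ childrenOf (rhs X)
  not_redundant : ∀ X Y, rhs X ≠ none → rhs X = rhs Y → X = Y
  not_useless : ∀ X, rhs X ≠ none →
    Relation.ReflTransGen (fun Y Z => Z ∈ childrenOf (rhs Y)) start X

namespace RLSLP

variable {α : Type*} (G : RLSLP α)

/-- The set `𝒱` of variables. -/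
def vars : Set ℕ := {X | G.rhs X ≠ none}

/-- The ordered children of a node labelled `X` in a derivation tree. -/
def children (X : ℕ) : List ℕ := childrenOf (G.rhs X)

/-- The string `val(X)` derived by `X`. -/
def val (X : ℕ) : List α :=
  match _h : G.rhs X with
  | none => []
  | some (.char a) => [a]
  | some (.pair l r) => val l ++ val r
  | some (.pow x k) => if _hk : k = 0 then [] else (List.replicate k (val x)).flatten
termination_by G.acyclic.wrap X
decreasing_by
  all_goals
    change _ ∈ childrenOf (G.rhs X)
    rw [_h]
    simp [childrenOf, WellFounded.wrap, *]

/-- `val⁺` of a sequence of variables. -/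
def valPlus (y : List ℕ) : List α := (y.map G.val).flatten

/-- The nodes of the derivation tree of `X` are addressed by paths from the root: the path
`i₁, i₂, …` goes to child number `i₁` (from `0`) of the root, then to its child number `i₂`, and so
on. `label X π` is the variable at the node `π`, and `none` if the tree has no such node. The
terminal characters below the variables `X → a` are not counted as nodes. -/
def label (X : ℕ) : List ℕ → Option ℕ
  | [] => some X
  | i :: π =>
    match (G.children X)[i]? with
    | none => none
    | some Y => label Y π

/-- The position (from `0`) in `val(X)` at which the string derived by the node `π` of the
derivation tree of `X` begins. -/
def offset (X : ℕ) : List ℕ → ℕ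
  | [] => 0
  | i :: π =>
    match (G.children X)[i]? with
    | none => 0
    | some Y => (G.valPlus ((G.children X).take i)).length + offset Y π

/-! ### Signature encodings -/

open Classical in
/-- `Sig` on characters, pairs and runs: the left-hand side of the assignment with the given
right-hand side, if there is one. -/
noncomputable def sig (x : Rhs α) : Option ℕ :=
  if h : ∃ e, G.rhs e = some x then some h.choose else none

/-- `Sig` on blocks of length two to four, evaluated from left to right. -/
noncomputable def sigBlock : List ℕ → Option ℕ
  | [a, b] => G.sig (.pair a b)
  | [a, b, c] => (G.sig (.pair a b)).bind fun u => G.sig (.pair u c)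
  | [a, b, c, d] =>
    (G.sig (.pair a b)).bind fun u => (G.sig (.pair u c)).bind fun v => G.sig (.pair v d)
  | _ => none

/-- `Sig⁺` of a string. -/
noncomputable def sigChars (T : List α) : Option (List ℕ) :=
  T.mapM fun a => G.sig (.char a)

/-- `Sig⁺` of a sequence of runs. -/
noncomputable def sigRuns (s : List (ℕ × ℕ)) : Option (List ℕ) :=
  s.mapM fun r => G.sig (.pow r.1 r.2)

/-- `Sig⁺` of a sequence of blocks. -/
noncomputable def sigBlocks (q : List (List ℕ)) : Option (List ℕ) :=
  q.mapM G.sigBlock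

/-- `Shrink_t^T`, if all signatures it needs are defined. -/
noncomputable def shrink {W : ℕ} (f : (Fin (logStar W + 11) → ℕ) → Bool) (T : List α) :
    ℕ → Option (List ℕ)
  | 0 => G.sigChars T
  | t + 1 =>
    (shrink f T t).bind fun s => (G.sigRuns (epow s)).bind fun p => G.sigBlocks (eblock f p)

/-- `Pow_t^T`, if all signatures it needs are defined. -/
noncomputable def pow {W : ℕ} (f : (Fin (logStar W + 11) → ℕ) → Bool) (T : List α) (t : ℕ) :
    Option (List ℕ) :=
  (G.shrink f T t).bind fun s => G.sigRuns (epow s)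

/-- `G` is the signature encoding of `T`, for the parsing function `f` and with signatures in
`[1..M]`: all signatures in `Shrink_t^T` and `Pow_t^T` for `t ≤ h` are defined and the start symbol
is the single element of `Pow_h^T`, where `h` is the least `t` with `|Pow_t^T| = 1`. (There are no
other assignments than those needed for this, since `G` has no useless variables.) -/
def IsSignatureEncoding (M : ℕ) (f : (Fin (logStar M + 11) → ℕ) → Bool) (T : List α) : Prop :=
  (∀ X ∈ G.vars, X ≤ M) ∧
  ∃ h, G.pow f T h = some [G.start] ∧ ∀ t < h, ∀ p, G.pow f T t = some p → p.length ≠ 1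

/-- The level of a variable. In a signature encoding, `Shrink_0` consists of characters, `Pow_t`
of runs of signatures from `Shrink_t`, and the signatures produced for `Shrink_{t+1}` (those of
blocks and those of the proper prefixes of blocks of length three and four) are pairs whose right
component is in `Pow_t`; so the signatures of level `t` are those produced by `Shrink_t` or
`Pow_t`. -/
def level (X : ℕ) : ℕ :=
  match h : G.rhs X with
  | none => 0
  | some (.char _) => 0
  | some (.pair _ r) => level r + 1
  | some (.pow x k) => if _hk : k = 0 then 0 else level x
termination_by G.acyclic.wrap X
decreasing_by
  all_goals
    change _ ∈ childrenOf (G.rhs X)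
    rw [h]
    simp [childrenOf, WellFounded.wrap, *]

/-! ### Common sequences -/

end RLSLP

/-- `L̂`: the longest prefix of `s` that consists of a single run. -/
def hatL (s : List ℕ) : List ℕ := s.takeWhile fun x => x == s.headD 0

/-- `R̂`: the longest suffix of `s` that consists of a single run. -/
def hatR (s : List ℕ) : List ℕ := (hatL s.reverse).reverse

/-- The length of `L`, the shortest prefix of `p` of length at least `Δ_L` such that `d[|L|+1] = 1`
(positions counted from `1`). -/
noncomputable def lenL {W : ℕ} (f : (Fin (logStar W + 11) → ℕ) → Bool) (p : List ℕ) : ℕ :=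
  sInf {l | deltaL W ≤ l ∧ l < p.length ∧ bit f p l = true}

/-- The length of `R`, the shortest suffix of `p` of length at least `Δ_R + 1` such that
`d[|d|-|R|+1] = 1` (positions counted from `1`). -/
noncomputable def lenR {W : ℕ} (f : (Fin (logStar W + 11) → ℕ) → Bool) (p : List ℕ) : ℕ :=
  sInf {r | deltaR + 1 ≤ r ∧ r ≤ p.length ∧ bit f p (p.length - r) = true}

/-- The list `l` without its first `a` and its last `b` entries. -/
def trim {β : Type*} (a b : ℕ) (l : List β) : List β := (l.take (l.length - b)).drop a

namespace RLSLP

variable {α : Type*} (G : RLSLP α)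

/-- The step from `XShrink_t` to `XPow_t`: remove the first and the last run, and apply `Sig⁺` to
the runs that remain. -/
noncomputable def xpowStep (s : List ℕ) : Option (List ℕ) :=
  G.sigRuns (epow (trim (hatL s).length (hatR s).length s))

/-- The step from `XPow_t` to `XShrink_{t+1}`: with the bits of all of `XPow_t`, remove the prefix
`L_t` and the suffix `R_t`, and apply `Sig⁺` to the blocks of the sequence that remains. -/
noncomputable def xshrinkStep {W : ℕ} (f : (Fin (logStar W + 11) → ℕ) → Bool) (p : List ℕ) :
    Option (List ℕ) :=
  G.sigBlocks (cut (trim (lenL f p) (lenR f p) (withBits f p)))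

/-- `XShrink_t^P`. -/
noncomputable def xshrink {W : ℕ} (f : (Fin (logStar W + 11) → ℕ) → Bool) (P : List α) :
    ℕ → Option (List ℕ)
  | 0 => G.sigChars P
  | t + 1 => (xshrink f P t).bind fun s => (G.xpowStep s).bind fun p => G.xshrinkStep f p

/-- `h^P`: the least `t` such that `|Epow(XShrink_t^P)| ≤ Δ_L + Δ_R + 9`. -/
noncomputable def hP {W : ℕ} (f : (Fin (logStar W + 11) → ℕ) → Bool) (P : List α) : ℕ :=
  sInf {t | ∃ s, G.xshrink f P t = some s ∧ (epow s).length ≤ deltaL W + deltaR + 9}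

/-- `L̂_t^P L_t^P`, where `L_t^P` is a prefix of `XPow_t^P`. -/
noncomputable def leftPart {W : ℕ} (f : (Fin (logStar W + 11) → ℕ) → Bool) (P : List α) (t : ℕ) :
    Option (List ℕ) :=
  (G.xshrink f P t).bind fun s => (G.xpowStep s).bind fun p =>
    some (hatL s ++ p.take (lenL f p))

/-- `R_t^P R̂_t^P`, where `R_t^P` is a suffix of `XPow_t^P`. -/
noncomputable def rightPart {W : ℕ} (f : (Fin (logStar W + 11) → ℕ) → Bool) (P : List α) (t : ℕ) :
    Option (List ℕ) :=
  (G.xshrink f P t).bind fun s => (G.xpowStep s).bind fun p =>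
    some (p.drop (p.length - lenR f p) ++ hatR s)

/-- The common sequence of `P`, with `h = h^P`:
`Uniq(P) = L̂_0 L_0 ⋯ L̂_{h-1} L_{h-1} XShrink_h R_{h-1} R̂_{h-1} ⋯ R_0 R̂_0`. -/
noncomputable def uniq {W : ℕ} (f : (Fin (logStar W + 11) → ℕ) → Bool) (P : List α) :
    Option (List ℕ) :=
  ((List.range (G.hP f P)).mapM (G.leftPart f P)).bind fun l =>
  (G.xshrink f P (G.hP f P)).bind fun m =>
  ((List.range (G.hP f P)).reverse.mapM (G.rightPart f P)).bind fun r =>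
    some (l.flatten ++ m ++ r.flatten)

/-- The node `π` of the derivation tree of `e` represents the `j`-th entry of the sequence `U` of
signatures that is read in `val(e)` from position `i` on (all counted from `0`). -/
def RepresentsEntry (e i : ℕ) (U : List ℕ) (j : ℕ) (π : List ℕ) : Prop :=
  ∃ x, U[j]? = some x ∧ G.label e π = some x ∧
    G.offset e π = i + (G.valPlus (U.take j)).length

/-- The occurrence of `P` at position `i` of `val(e)` is represented by the sequence `U` of
signatures in the derivation tree of `e`. -/
def Represents (e i : ℕ) (P : List α) (U : List ℕ) : Prop :=
  G.valPlus U = P ∧ ∀ j < U.length, ∃ π, G.RepresentsEntry e i U j π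

/-- The nodes of the subtree of the derivation tree of `e` that is induced by the paths from the
root to the parents of the nodes representing `U` at position `i`. -/
def inducedSubtree (e i : ℕ) (U : List ℕ) : Set (List ℕ) :=
  {π | ∃ (j : ℕ) (μ : List ℕ) (c : ℕ), G.RepresentsEntry e i U j (μ ++ [c]) ∧ π <+: μ}

/-- The nodes of level `t` in the derivation tree of `e`. -/
def levelNodes (e t : ℕ) : Set (List ℕ) := {π | ∃ x, G.label e π = some x ∧ G.level x = t}

end RLSLP

end SigEnc

/-!
By local consistency, whether a block begins at a position is decided by the entries in a window
around it. Hence, once the runs and blocks that could depend on the context are cut off at both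
ends, the sequences `XShrink_t` and `XPow_t` computed from `P` alone are factors of `Shrink_t` and
`Pow_t` at the occurrence of `P`. So `Uniq(P)` derives `P`, and each of its entries labels a node
of the derivation tree that lies on the layer in which it was created.

A node of level `s` in the induced subtree lies strictly above an entry of `Uniq(P)`, so it is at
one of the two ends of the occurrence or its part of the string contains the beginning of a run of
level `s` inside the part represented by entries of level at most `s`. Every round splits off
`O(log* M)` runs on each side, and from one level to the next the number of runs at least halves;
so each level contributes `O(log* M)` nodes. After the last round, at level `h^P ≤ log₂ |P|`, only
`O(log* M)` runs remain, and as their number decays geometrically, the levels from `h^P` on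
contribute `O(log* M)` further nodes besides a constant number each. As there are at most `log₂ |s|`
levels, the total is `O(log₂ |s| + log₂ |P| · log* M)`.
-/

namespace SigEnc

/-! ### Counting -/

theorem two_mul_card_le_of_interleaved {ι : Type*} [LinearOrder ι] {A B : Finset ι} {g : ι → ι}
    (hAB : A ⊆ B) (hlt : ∀ o ∈ A, o < g o)
    (hg : ∀ o ∈ A, ∀ o' ∈ A, o < o' → g o ∈ B ∧ g o < o') :
    2 * A.card ≤ B.card + 1 := by
  rcases A.eq_empty_or_nonempty with rfl | hne
  · simp
  have hmono : StrictMonoOn g A := fun o ho o' ho' h => (hg o ho o' ho' h).2.trans (hlt o' ho')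
  have hdisj : Disjoint A (A.image g) := by
    simp only [Finset.disjoint_left, Finset.mem_image, not_exists, not_and]
    rintro _ ho p hp rfl
    exact (hg p hp _ ho (hlt p hp)).2.false
  have hsub : A ∪ A.image g ⊆ insert (g (A.max' hne)) B := by
    refine Finset.union_subset (hAB.trans (Finset.subset_insert _ _)) ?_
    rw [Finset.image_subset_iff]
    intro o ho
    rcases (A.le_max' o ho).eq_or_lt with h | h
    · exact h ▸ Finset.mem_insert_self _ _
    · exact Finset.mem_insert_of_mem (hg o ho _ (A.max'_mem hne) h).1
  calc 2 * A.card = (A ∪ A.image g).card := by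
        rw [Finset.card_union_of_disjoint hdisj, Finset.card_image_of_injOn hmono.injOn, two_mul]
    _ ≤ B.card + 1 := (Finset.card_le_card hsub).trans (Finset.card_insert_le _ _)

/-- The number of elements of `S` in the half-open interval `[x, y)`. -/
noncomputable def countIn (S : Set ℕ) (x y : ℕ) : ℕ := (S ∩ Set.Ico x y).ncard

theorem finite_inter_Ico (S : Set ℕ) (x y : ℕ) : (S ∩ Set.Ico x y).Finite :=
  (Set.finite_Ico x y).subset Set.inter_subset_right

theorem countIn_mono (S : Set ℕ) {x y x' y' : ℕ} (hx : x' ≤ x) (hy : y ≤ y') :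
    countIn S x y ≤ countIn S x' y' :=
  Set.ncard_le_ncard (Set.inter_subset_inter_right _ (Set.Ico_subset_Ico hx hy))
    (finite_inter_Ico _ _ _)

theorem countIn_le_add (S : Set ℕ) (x y z : ℕ) :
    countIn S x z ≤ countIn S x y + countIn S y z := by
  refine le_trans (Set.ncard_le_ncard ?_ ((finite_inter_Ico S x y).union (finite_inter_Ico S y z)))
    (Set.ncard_union_le _ _)
  rw [← Set.inter_union_distrib_left]
  exact Set.inter_subset_inter_right _ Set.Ico_subset_Ico_union_Ico

theorem countIn_of_le (S : Set ℕ) {x y : ℕ} (h : y ≤ x) : countIn S x y = 0 := by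
  simp [countIn, Set.Ico_eq_empty_of_le h]

theorem two_mul_countIn_le {S S' : Set ℕ} (hS : S' ⊆ S)
    (h : ∀ o ∈ S', ∃ o' ∈ S, o < o' ∧ ∀ o'' ∈ S', o < o'' → o' < o'') (x y : ℕ) :
    2 * countIn S' x y ≤ countIn S x y + 1 := by
  choose! g hgS hlt hbefore using h
  have hfin := finite_inter_Ico S x y
  have hfin' := finite_inter_Ico S' x y
  rw [countIn, countIn, Set.ncard_eq_toFinset_card _ hfin, Set.ncard_eq_toFinset_card _ hfin']
  apply two_mul_card_le_of_interleaved (g := g)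
  · exact Set.Finite.toFinset_subset_toFinset.2 (Set.inter_subset_inter_left _ hS)
  · exact fun o ho => hlt o (hfin'.mem_toFinset.1 ho).1
  · intro o ho o' ho' hoo'
    obtain ⟨hoS, hxo, -⟩ := hfin'.mem_toFinset.1 ho
    obtain ⟨hoS', -, hoy⟩ := hfin'.mem_toFinset.1 ho'
    have hgo := hbefore o hoS o' hoS' hoo'
    exact ⟨hfin.mem_toFinset.2 ⟨hgS o hoS, hxo.trans (hlt o hoS).le, hgo.trans hoy⟩, hgo⟩

/-! ### Partial maps on lists -/

section mapM

variable {β γ : Type*} {g : β → Option γ} {l m : List β} {r : List γ}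

theorem mapM_eq_some_iff : l.mapM g = some r ↔ List.Forall₂ (fun a b => g a = some b) l r := by
  induction l generalizing r with
  | nil => simp [eq_comm]
  | cons a l ih =>
    rw [List.mapM_cons, List.forall₂_cons_left_iff]
    simp only [Option.bind_eq_bind, Option.bind_eq_some_iff, Option.pure_def, Option.some.injEq, ih]
    grind

theorem mapM_append_eq_some_iff :
    (l ++ m).mapM g = some r ↔ ∃ a b, l.mapM g = some a ∧ m.mapM g = some b ∧ a ++ b = r := by
  rw [List.mapM_append]
  simp only [Option.bind_eq_bind, Option.bind_eq_some_iff, Option.pure_def, Option.some.injEq]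
  grind

theorem length_eq_of_mapM_eq_some (h : l.mapM g = some r) : l.length = r.length :=
  (mapM_eq_some_iff.1 h).length_eq

theorem exists_mem_right_of_forall₂ {R : β → γ → Prop} (h : List.Forall₂ R l r) {a : β}
    (ha : a ∈ l) : ∃ b ∈ r, R a b := by
  induction h with
  | nil => simp at ha
  | cons _ _ _ => grind

theorem exists_mem_left_of_mapM (h : l.mapM g = some r) {b : γ} (hb : b ∈ r) :
    ∃ a ∈ l, g a = some b :=
  exists_mem_right_of_forall₂ (mapM_eq_some_iff.1 h).flip hb

theorem exists_mem_right_of_mapM (h : l.mapM g = some r) {a : β} (ha : a ∈ l) :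
    ∃ b ∈ r, g a = some b :=
  exists_mem_right_of_forall₂ (mapM_eq_some_iff.1 h) ha

end mapM

end SigEnc

namespace SigEnc.RLSLP

variable {α : Type*} {G : RLSLP α}

/-! ### Derivation trees -/

@[simp] theorem valPlus_nil : G.valPlus [] = [] := rfl

@[simp] theorem valPlus_cons (x : ℕ) (y : List ℕ) :
    G.valPlus (x :: y) = G.val x ++ G.valPlus y := rfl

@[simp] theorem valPlus_append (x y : List ℕ) :
    G.valPlus (x ++ y) = G.valPlus x ++ G.valPlus y := by
  simp [valPlus]

theorem valPlus_replicate (k x : ℕ) :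
    G.valPlus (List.replicate k x) = (List.replicate k (G.val x)).flatten := by
  simp [valPlus]

theorem length_valPlus_le_of_prefix {y z : List ℕ} (h : y <+: z) :
    (G.valPlus y).length ≤ (G.valPlus z).length := by
  obtain ⟨w, rfl⟩ := h
  simp

theorem length_valPlus_take_succ {y : List ℕ} {i x : ℕ} (h : y[i]? = some x) :
    (G.valPlus (y.take (i + 1))).length = (G.valPlus (y.take i)).length + (G.val x).length := by
  simp [List.take_add_one, h]

theorem length_valPlus_take_add_le {y : List ℕ} {i x : ℕ} (h : y[i]? = some x) :
    (G.valPlus (y.take i)).length + (G.val x).length ≤ (G.valPlus y).length := by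
  rw [← length_valPlus_take_succ h]
  exact length_valPlus_le_of_prefix (List.take_prefix _ _)

theorem length_valPlus_take_add_le_of_lt {y : List ℕ} {i j x : ℕ} (h : y[i]? = some x)
    (hij : i < j) :
    (G.valPlus (y.take i)).length + (G.val x).length ≤ (G.valPlus (y.take j)).length :=
  (length_valPlus_take_succ h).symm.le.trans
    (length_valPlus_le_of_prefix (List.take_prefix_take_left hij))

theorem val_of_char {X : ℕ} {a : α} (h : G.rhs X = some (.char a)) : G.val X = [a] := by
  rw [val]; split <;> simp_all

theorem val_of_pair {X l r : ℕ} (h : G.rhs X = some (.pair l r)) :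
    G.val X = G.val l ++ G.val r := by
  rw [val]; split <;> simp_all

theorem val_of_pow {X x k : ℕ} (h : G.rhs X = some (.pow x k)) :
    G.val X = (List.replicate k (G.val x)).flatten := by
  rw [val]; split <;> simp_all

theorem level_of_char {X : ℕ} {a : α} (h : G.rhs X = some (.char a)) : G.level X = 0 := by
  rw [level]; split <;> simp_all

theorem level_of_pair {X l r : ℕ} (h : G.rhs X = some (.pair l r)) :
    G.level X = G.level r + 1 := by
  rw [level]; split <;> simp_all

theorem level_of_pow {X x k : ℕ} (h : G.rhs X = some (.pow x k)) :
    G.level X = G.level x := by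
  have hk := G.exponent_pos X x k h
  rw [level]; split <;> simp_all
  omega

theorem children_of_char {X : ℕ} {a : α} (h : G.rhs X = some (.char a)) : G.children X = [] := by
  simp [children, h, childrenOf]

theorem children_of_pair {X l r : ℕ} (h : G.rhs X = some (.pair l r)) :
    G.children X = [l, r] := by
  simp [children, h, childrenOf]

theorem children_of_pow {X x k : ℕ} (h : G.rhs X = some (.pow x k)) :
    G.children X = List.replicate k x := by
  simp [children, h, childrenOf]

theorem children_of_pow_zero {X x k : ℕ} (h : G.rhs X = some (.pow x k)) :
    (G.children X)[0]? = some x := by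
  rw [children_of_pow h, List.getElem?_replicate_of_lt (G.exponent_pos _ _ _ h)]

theorem valPlus_children {X : ℕ} (h : G.children X ≠ []) :
    G.valPlus (G.children X) = G.val X := by
  rcases hx : G.rhs X with _ | (a | ⟨l, r⟩ | ⟨x, k⟩)
  · simp [children, hx, childrenOf] at h
  · exact absurd (children_of_char hx) h
  · simp [children_of_pair hx, val_of_pair hx]
  · rw [children_of_pow hx, val_of_pow hx, valPlus_replicate]

theorem valPlus_children_of_getElem? {X i Y : ℕ} (h : (G.children X)[i]? = some Y) :
    G.valPlus (G.children X) = G.val X :=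
  valPlus_children (List.ne_nil_of_mem (List.mem_of_getElem? h))

@[simp] theorem offset_nil (X : ℕ) : G.offset X [] = 0 := rfl

theorem label_cons {X i Y : ℕ} (h : (G.children X)[i]? = some Y) (π : List ℕ) :
    G.label X (i :: π) = G.label Y π := by
  rw [label, h]

theorem offset_cons {X i Y : ℕ} (h : (G.children X)[i]? = some Y) (π : List ℕ) :
    G.offset X (i :: π) = (G.valPlus ((G.children X).take i)).length + G.offset Y π := by
  rw [offset, h]

theorem label_cons_eq_some {X i Z : ℕ} {π : List ℕ} (h : G.label X (i :: π) = some Z) :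
    ∃ Y, (G.children X)[i]? = some Y ∧ G.label Y π = some Z := by
  rcases hY : (G.children X)[i]? with _ | Y
  · rw [label, hY] at h; cases h
  · exact ⟨Y, rfl, by rwa [label_cons hY] at h⟩

theorem label_append {X Y : ℕ} {π : List ℕ} (h : G.label X π = some Y) (σ : List ℕ) :
    G.label X (π ++ σ) = G.label Y σ := by
  induction π generalizing X with
  | nil => cases h; rfl
  | cons i π ih =>
    obtain ⟨Z, hZ, hZ'⟩ := label_cons_eq_some h
    rw [List.cons_append, label_cons hZ, ih hZ']

theorem exists_label_of_append {X Z : ℕ} {π σ : List ℕ} (h : G.label X (π ++ σ) = some Z) :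
    ∃ Y, G.label X π = some Y ∧ G.label Y σ = some Z := by
  induction π generalizing X with
  | nil => exact ⟨X, rfl, h⟩
  | cons i π ih =>
    obtain ⟨Y, hY, hY'⟩ := label_cons_eq_some h
    simpa only [label_cons hY] using ih hY'

theorem offset_append {X Y : ℕ} {π : List ℕ} (h : G.label X π = some Y) (σ : List ℕ) :
    G.offset X (π ++ σ) = G.offset X π + G.offset Y σ := by
  induction π generalizing X with
  | nil => cases h; simp
  | cons i π ih =>
    obtain ⟨Z, hZ, hZ'⟩ := label_cons_eq_some h
    rw [List.cons_append, offset_cons hZ, offset_cons hZ, ih hZ', add_assoc]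

theorem val_eq_append_of_label {X Y : ℕ} {π : List ℕ} (h : G.label X π = some Y) :
    ∃ u v, G.val X = u ++ G.val Y ++ v ∧ u.length = G.offset X π := by
  induction π generalizing X with
  | nil => cases h; exact ⟨[], [], by simp⟩
  | cons i π ih =>
    obtain ⟨Z, hZ, hZ'⟩ := label_cons_eq_some h
    obtain ⟨u, v, huv, hu⟩ := ih hZ'
    refine ⟨G.valPlus ((G.children X).take i) ++ u, v ++ G.valPlus ((G.children X).drop (i + 1)),
      ?_, by rw [offset_cons hZ]; simp [hu]⟩
    rw [← valPlus_children_of_getElem? hZ]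
    conv_lhs => rw [← List.take_append_drop (i + 1) (G.children X), List.take_add_one, hZ]
    simp [huv]

theorem offset_add_le {X Y : ℕ} {π : List ℕ} (h : G.label X π = some Y) :
    G.offset X π + (G.val Y).length ≤ (G.val X).length := by
  obtain ⟨u, v, huv, hu⟩ := val_eq_append_of_label h
  simp only [huv, ← hu, List.length_append]
  omega

theorem prefix_or_prefix_of_overlap {X Y Z : ℕ} {π σ : List ℕ} (hπ : G.label X π = some Y)
    (hσ : G.label X σ = some Z) (hlt : G.offset X π < G.offset X σ + (G.val Z).length)
    (hlt' : G.offset X σ < G.offset X π + (G.val Y).length) : π <+: σ ∨ σ <+: π := by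
  induction π generalizing X σ with
  | nil => exact .inl List.nil_prefix
  | cons i π ih =>
    rcases σ with _ | ⟨j, σ⟩
    · exact .inr List.nil_prefix
    obtain ⟨A, hA, hA'⟩ := label_cons_eq_some hπ
    obtain ⟨B, hB, hB'⟩ := label_cons_eq_some hσ
    rw [offset_cons hA, offset_cons hB] at hlt hlt'
    have hAle := offset_add_le hA'
    have hBle := offset_add_le hB'
    rcases lt_trichotomy i j with hij | rfl | hij
    · have := length_valPlus_take_add_le_of_lt (G := G) hA hij
      omega
    · obtain rfl : A = B := Option.some.inj (hA.symm.trans hB)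
      simpa only [List.cons_prefix_cons, true_and] using ih hA' hB' (by omega) (by omega)
    · have := length_valPlus_take_add_le_of_lt (G := G) hB hij
      omega

theorem exists_label_of_mem_vars {x : ℕ} (hx : x ∈ G.vars) :
    ∃ π, G.label G.start π = some x := by
  induction G.not_useless x hx with
  | refl => exact ⟨[], rfl⟩
  | @tail y z _ hz ih =>
    have hyv : y ∈ G.vars := by
      intro h
      rw [h] at hz
      simp [childrenOf] at hz
    obtain ⟨π, hπ⟩ := ih hyv
    obtain ⟨i, hi⟩ := List.mem_iff_getElem?.1 hz
    exact ⟨π ++ [i], by rw [label_append hπ]; exact label_cons hi []⟩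

/-! ### Ranks -/

/-- The position of a variable of a signature encoding in the order in which the construction
creates signatures: characters have rank `0`, runs of elements of `Shrink_t` have rank `4 * t + 1`,
and a pair that is the signature of the first `j` entries of a block of `Pow_t` (`2 ≤ j ≤ 4`) has
rank `4 * t + j`. In particular the elements of `Shrink_t` have ranks between `4 * t - 2` and
`4 * t`. -/
inductive HasRank (G : RLSLP α) : ℕ → ℕ → Prop
  | char {x : ℕ} {a : α} (h : G.rhs x = some (.char a)) : HasRank G 0 x
  | run {x y k n t : ℕ} (h : G.rhs x = some (.pow y k)) (hn : 4 * t ≤ n + 2) (hn' : n ≤ 4 * t)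
      (hy : HasRank G n y) : HasRank G (4 * t + 1) x
  | pair {x l r t j : ℕ} (h : G.rhs x = some (.pair l r)) (hj : 1 ≤ j) (hj' : j ≤ 3)
      (hl : HasRank G (4 * t + j) l) (hr : HasRank G (4 * t + 1) r) : HasRank G (4 * t + j + 1) x

namespace HasRank

variable {m n t x y : ℕ}

theorem level_eq (h : HasRank G n x) : G.level x = (n + 2) / 4 := by
  induction h with
  | char h => exact level_of_char h
  | run h _ _ _ ih => rw [level_of_pow h, ih]; omega
  | pair h _ _ _ _ _ ih => rw [level_of_pair h, ih]; omega

theorem unique (hm : HasRank G m x) (hn : HasRank G n x) : m = n := by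
  induction hm generalizing n with
  | char h => cases hn <;> simp_all
  | run h _ _ _ ih =>
    cases hn with
    | char h' => simp_all
    | run h' _ _ hy' =>
      obtain ⟨rfl, rfl⟩ : _ ∧ _ := by simpa [h] using h'
      have := ih hy'
      omega
    | pair h' => simp_all
  | pair h _ _ _ _ ihl ihr =>
    cases hn with
    | char h' => simp_all
    | run h' => simp_all
    | pair h' _ _ hl' hr' =>
      obtain ⟨rfl, rfl⟩ : _ ∧ _ := by simpa [h] using h'
      have := ihl hl'
      have := ihr hr'
      omega

theorem mem_vars (h : HasRank G n x) : x ∈ G.vars := by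
  cases h <;> simp_all [vars]

theorem children_ne_nil (h : HasRank G n x) (hn : 0 < n) : G.children x ≠ [] := by
  cases h with
  | char => omega
  | run h => exact List.ne_nil_of_mem (List.mem_of_getElem? (children_of_pow_zero h))
  | pair h => simp [children_of_pair h]

theorem exists_of_mem_children (h : HasRank G n x) (hy : y ∈ G.children x) :
    ∃ m < n, HasRank G m y := by
  cases h with
  | char h => simp [children_of_char h] at hy
  | run h _ _ h' =>
    rw [children_of_pow h] at hy
    exact ⟨_, by omega, List.eq_of_mem_replicate hy ▸ h'⟩
  | pair h _ _ hl hr =>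
    simp only [children_of_pair h, List.mem_cons, List.not_mem_nil, or_false] at hy
    rcases hy with rfl | rfl
    · exact ⟨_, by omega, hl⟩
    · exact ⟨_, by omega, hr⟩

theorem exists_of_label {σ : List ℕ} (h : HasRank G n x) (hσ : G.label x σ = some y) :
    ∃ m, HasRank G m y ∧ (σ ≠ [] → m < n) := by
  induction σ generalizing x n with
  | nil => cases hσ; exact ⟨n, h, by simp⟩
  | cons i σ ih =>
    obtain ⟨z, hz, hz'⟩ := label_cons_eq_some hσ
    obtain ⟨k, hk, hzk⟩ := h.exists_of_mem_children (List.mem_of_getElem? hz)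
    obtain ⟨m, hm, hmk⟩ := ih hzk hz'
    refine ⟨m, hm, fun _ => ?_⟩
    rcases eq_or_ne σ [] with rfl | hσ
    · cases hz'
      exact hm.unique hzk ▸ hk
    · exact (hmk hσ).trans hk

theorem two_pow_le_length_val (h : HasRank G n x) : 2 ^ ((n + 2) / 4) ≤ (G.val x).length := by
  induction h with
  | char h => simp [val_of_char h]
  | @run x y k n t h hn hn' _ ih =>
    have hk := G.exponent_pos _ _ _ h
    rw [show (n + 2) / 4 = t by omega] at ih
    rw [show (4 * t + 1 + 2) / 4 = t by omega, val_of_pow h]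
    simp only [List.length_flatten, List.map_replicate, List.sum_replicate, smul_eq_mul]
    nlinarith
  | @pair x l r t j h hj hj' _ _ ihl ihr =>
    have hl : 2 ^ t ≤ (G.val l).length :=
      le_trans (Nat.pow_le_pow_right (by norm_num) (by omega)) ihl
    rw [show (4 * t + 1 + 2) / 4 = t by omega] at ihr
    rw [show (4 * t + j + 1 + 2) / 4 = t + 1 by omega, val_of_pair h, List.length_append, pow_succ]
    omega

theorem length_val_pos (h : HasRank G n x) : 0 < (G.val x).length :=
  lt_of_lt_of_le (by positivity) h.two_pow_le_length_val

theorem eq_of_prefix {X : ℕ} {π σ : List ℕ} (hx : HasRank G n x) (hy : HasRank G n y)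
    (hπ : G.label X π = some x) (hσ : G.label X σ = some y) (h : π <+: σ) : π = σ := by
  obtain ⟨τ, rfl⟩ := h
  rw [label_append hπ] at hσ
  obtain ⟨m, hm, hmn⟩ := hx.exists_of_label hσ
  by_contra hτ
  exact (hmn (by simpa using hτ)).ne (hm.unique hy)

theorem eq_of_overlap {X : ℕ} {π σ : List ℕ} (hx : HasRank G n x) (hy : HasRank G n y)
    (hπ : G.label X π = some x) (hσ : G.label X σ = some y)
    (hlt : G.offset X π < G.offset X σ + (G.val y).length)
    (hlt' : G.offset X σ < G.offset X π + (G.val x).length) : π = σ := by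
  rcases prefix_or_prefix_of_overlap hπ hσ hlt hlt' with h | h
  · exact hx.eq_of_prefix hy hπ hσ h
  · exact (hy.eq_of_prefix hx hσ hπ h).symm

end HasRank

/-! ### Positions of runs -/

/-- The positions in `val(r)` at which the runs of elements of `Shrink_t` begin, read off from the
derivation tree of `r`. -/
def runStarts (G : RLSLP α) (r t : ℕ) : Set ℕ :=
  {o | ∃ π x, G.label r π = some x ∧ HasRank G (4 * t + 1) x ∧ G.offset r π = o}

theorem add_mem_runStarts {r x t o : ℕ} {π : List ℕ} (hπ : G.label r π = some x)
    (ho : o ∈ G.runStarts x t) : G.offset r π + o ∈ G.runStarts r t := by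
  obtain ⟨σ, y, hσ, hy, rfl⟩ := ho
  exact ⟨π ++ σ, y, (label_append hπ σ).trans hσ, hy, offset_append hπ σ⟩

theorem runStarts_subset_of_head_child {x y t : ℕ} (h : (G.children x)[0]? = some y) :
    G.runStarts y t ⊆ G.runStarts x t := fun o ho => by
  have hy : G.label x [0] = some y := label_cons h []
  simpa [offset_cons h] using add_mem_runStarts hy ho

theorem lt_length_of_mem_runStarts {x t o : ℕ} (ho : o ∈ G.runStarts x t) :
    o < (G.val x).length := by
  obtain ⟨σ, y, hσ, hy, rfl⟩ := ho
  have := offset_add_le hσ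
  have := hy.length_val_pos
  omega

namespace HasRank

variable {n t x : ℕ}

theorem zero_mem_runStarts (h : HasRank G n x) (hn : 4 * t + 1 ≤ n) (hn' : n ≤ 4 * t + 5) :
    0 ∈ G.runStarts x t := by
  induction h with
  | char => omega
  | @run x y k m s h hm hm' hy ih =>
    rcases eq_or_ne s t with rfl | hst
    · exact ⟨[], x, rfl, hy.run h hm hm', rfl⟩
    exact runStarts_subset_of_head_child (children_of_pow_zero h) (ih (by omega) (by omega))
  | pair h _ _ _ _ ih _ =>
    exact runStarts_subset_of_head_child (by simp [children_of_pair h]) (ih (by omega) (by omega))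

theorem exists_pos_mem_runStarts (h : HasRank G n x) (hn : 4 * t + 2 ≤ n) (hn' : n ≤ 4 * t + 5) :
    ∃ o ∈ G.runStarts x t, 0 < o := by
  induction h with
  | char => omega
  | @run x y k n s h hn hn' _ ih =>
    obtain ⟨o, ho, hpos⟩ := ih (by omega) (by omega)
    exact ⟨o, runStarts_subset_of_head_child (children_of_pow_zero h) ho, hpos⟩
  | @pair x l r s j h _ _ hl hr =>
    obtain rfl : s = t := by omega
    have h1 : (G.children x)[1]? = some r := by simp [children_of_pair h]
    refine ⟨_, ⟨[1], r, label_cons h1 [], hr, rfl⟩, ?_⟩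
    simpa [offset_cons h1, children_of_pair h] using hl.length_val_pos

end HasRank

theorem runStarts_halving (r t x y : ℕ) :
    2 * countIn (G.runStarts r (t + 1)) x y ≤ countIn (G.runStarts r t) x y + 1 := by
  apply two_mul_countIn_le
  · rintro _ ⟨π, x, hπ, hx, rfl⟩
    exact add_mem_runStarts hπ (hx.zero_mem_runStarts (by omega) (by omega))
  · rintro _ ⟨π, x, hπ, hx, rfl⟩
    obtain ⟨o, ho, hpos⟩ := hx.exists_pos_mem_runStarts (t := t) (by omega) (by omega)
    refine ⟨_, add_mem_runStarts hπ ho, by omega, ?_⟩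
    rintro _ ⟨τ, w, hτ, hw, rfl⟩ hlt
    by_contra! hle
    have hox := lt_length_of_mem_runStarts ho
    obtain rfl := hx.eq_of_overlap hw hπ hτ (hlt.trans_le (Nat.le_add_right _ _)) (by omega)
    omega

theorem ncard_nodes_le {r n t x y : ℕ} (hn : 4 * t + 1 ≤ n) (hn' : n ≤ 4 * t + 5)
    {N : Set (List ℕ)} (hN : ∀ π ∈ N, ∃ z, G.label r π = some z ∧ HasRank G n z ∧
      x < G.offset r π + (G.val z).length ∧ G.offset r π < y) :
    N.Finite ∧ N.ncard ≤ countIn (G.runStarts r t) (x + 1) y + 1 := by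
  have hfin : (insert x (G.runStarts r t ∩ Set.Ico (x + 1) y)).Finite :=
    (finite_inter_Ico _ _ _).insert x
  have hmaps : Set.MapsTo (fun π => max x (G.offset r π)) N
      (insert x (G.runStarts r t ∩ Set.Ico (x + 1) y)) := by
    intro π hπ
    obtain ⟨z, hz, hrank, -, hlt⟩ := hN π hπ
    rcases le_or_gt (G.offset r π) x with h | h
    · exact .inl (max_eq_left h)
    · refine .inr ?_
      simp only [max_eq_right h.le]
      exact ⟨by simpa using add_mem_runStarts hz (hrank.zero_mem_runStarts hn hn'), h, hlt⟩
  have hinj : Set.InjOn (fun π => max x (G.offset r π)) N := by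
    intro π hπ σ hσ heq
    obtain ⟨z, hz, hzn, hzx, -⟩ := hN π hπ
    obtain ⟨w, hw, hwn, hwx, -⟩ := hN σ hσ
    have hz_pos := hzn.length_val_pos
    have hw_pos := hwn.length_val_pos
    simp only at heq
    exact hzn.eq_of_overlap hwn hz hw (by omega) (by omega)
  exact ⟨Set.Finite.of_injOn hmaps hinj hfin,
    (Set.ncard_le_ncard_of_injOn _ hmaps hinj hfin).trans (Set.ncard_insert_le _ _)⟩

end SigEnc.RLSLP

namespace SigEnc

/-! ### Runs -/

/-- The sequence with the given runs. -/
def expand (l : List (ℕ × ℕ)) : List ℕ := l.flatMap fun r => List.replicate r.2 r.1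

@[simp] theorem expand_cons (r : ℕ × ℕ) (l : List (ℕ × ℕ)) :
    expand (r :: l) = List.replicate r.2 r.1 ++ expand l := rfl

@[simp] theorem expand_append (l m : List (ℕ × ℕ)) :
    expand (l ++ m) = expand l ++ expand m := List.flatMap_append

@[simp] theorem epow_nil : epow [] = [] := rfl

theorem epow_singleton (a : ℕ) : epow [a] = [(a, 1)] := rfl

theorem epow_cons_of_eq {s : List ℕ} {b k : ℕ} {r : List (ℕ × ℕ)} (h : epow s = (b, k) :: r) :
    epow (b :: s) = (b, k + 1) :: r := by simp [epow, h]

theorem epow_cons_of_ne {s : List ℕ} {a b k : ℕ} {r : List (ℕ × ℕ)} (h : epow s = (b, k) :: r)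
    (hab : a ≠ b) : epow (a :: s) = (a, 1) :: (b, k) :: r := by simp [epow, h, hab]

theorem exists_epow_cons (a : ℕ) (s : List ℕ) : ∃ k r, epow (a :: s) = (a, k + 1) :: r := by
  rcases h : epow s with _ | ⟨⟨b, k⟩, r⟩
  · exact ⟨0, [], by simp [epow, h]⟩
  · rcases eq_or_ne a b with rfl | hab
    · exact ⟨k, r, epow_cons_of_eq h⟩
    · exact ⟨0, _, epow_cons_of_ne h hab⟩

theorem epow_cons_cons_self (a : ℕ) (s : List ℕ) :
    ∃ k r, epow (a :: s) = (a, k) :: r ∧ epow (a :: a :: s) = (a, k + 1) :: r := by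
  obtain ⟨k, r, h⟩ := exists_epow_cons a s
  exact ⟨k + 1, r, h, epow_cons_of_eq h⟩

theorem epow_cons_cons_of_ne {a b : ℕ} (hab : a ≠ b) (s : List ℕ) :
    epow (a :: b :: s) = (a, 1) :: epow (b :: s) := by
  obtain ⟨k, r, h⟩ := exists_epow_cons b s
  rw [epow_cons_of_ne h hab, h]

theorem length_epow_cons_cons (a b : ℕ) (s : List ℕ) :
    (epow (a :: b :: s)).length = (epow (b :: s)).length + if a = b then 0 else 1 := by
  rcases eq_or_ne a b with rfl | hab
  · obtain ⟨k, r, h, h'⟩ := epow_cons_cons_self a s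
    simp [h, h']
  · simp [epow_cons_cons_of_ne hab, hab]

/-- Induction over a sequence of numbers that tells whether the first two entries are equal, as
`epow` does. -/
theorem runInduction {p : List ℕ → Prop} (nil : p []) (singleton : ∀ a, p [a])
    (cons_self : ∀ a s, p (a :: s) → p (a :: a :: s))
    (cons_ne : ∀ a b s, a ≠ b → p (b :: s) → p (a :: b :: s)) : ∀ s, p s
  | [] => nil
  | [a] => singleton a
  | a :: b :: s => by
    have ih := runInduction nil singleton cons_self cons_ne (b :: s)
    rcases eq_or_ne a b with rfl | hab
    · exact cons_self a s ih
    · exact cons_ne a b s hab ih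

theorem expand_epow (s : List ℕ) : expand (epow s) = s := by
  induction s using runInduction with
  | nil => rfl
  | singleton a => rfl
  | cons_self a s ih =>
    obtain ⟨k, r, h, h'⟩ := epow_cons_cons_self a s
    rw [h, expand_cons] at ih
    rw [h', expand_cons, List.replicate_succ, List.cons_append, ih]
  | cons_ne a b s hab ih => rw [epow_cons_cons_of_ne hab, expand_cons, ih]; rfl

theorem length_epow_le (s : List ℕ) : (epow s).length ≤ s.length := by
  induction s using runInduction with
  | nil | singleton => simp [epow_singleton]
  | cons_self | cons_ne =>
    rw [length_epow_cons_cons]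
    split_ifs <;> grind

theorem mem_of_mem_epow {s : List ℕ} {r : ℕ × ℕ} (h : r ∈ epow s) : r.1 ∈ s := by
  induction s using runInduction with
  | nil => simp at h
  | singleton a => simp_all [epow_singleton]
  | cons_self a s ih =>
    obtain ⟨k, q, hq, hq'⟩ := epow_cons_cons_self a s
    grind
  | cons_ne a b s hab ih =>
    rw [epow_cons_cons_of_ne hab] at h
    grind

theorem isChain_epow (s : List ℕ) : (epow s).IsChain (fun r r' => r.1 ≠ r'.1) := by
  induction s using runInduction with
  | nil | singleton => simp [epow_singleton]
  | cons_self a s ih =>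
    obtain ⟨k, r, h, h'⟩ := epow_cons_cons_self a s
    rw [h, List.isChain_cons] at ih
    rw [h', List.isChain_cons]
    exact ih
  | cons_ne a b s hab ih =>
    obtain ⟨k, r, h⟩ := exists_epow_cons b s
    rw [epow_cons_cons_of_ne hab, h, List.isChain_cons_cons]
    exact ⟨hab, h ▸ ih⟩

/-- No run of `A ++ B` contains both the last entry of `A` and the first entry of `B`. -/
def RunBoundary (A B : List ℕ) : Prop := ∀ a ∈ A.getLast?, ∀ b ∈ B.head?, a ≠ b

theorem runBoundary_append_left_iff {A B : List ℕ} (D : List ℕ) (hA : A ≠ []) :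
    RunBoundary (D ++ A) B ↔ RunBoundary A B := by
  rw [RunBoundary, RunBoundary, List.getLast?_append_of_ne_nil _ hA]

theorem runBoundary_append_right_iff {A B : List ℕ} (D : List ℕ) (hB : B ≠ []) :
    RunBoundary A (B ++ D) ↔ RunBoundary A B := by
  rw [RunBoundary, RunBoundary, List.head?_append_of_ne_nil _ hB]

theorem RunBoundary.reverse {A B : List ℕ} (h : RunBoundary A B) :
    RunBoundary B.reverse A.reverse := by
  intro b hb a ha
  rw [List.getLast?_reverse] at hb
  rw [List.head?_reverse] at ha
  exact (h a ha b hb).symm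

theorem epow_append {A B : List ℕ} (h : RunBoundary A B) : epow (A ++ B) = epow A ++ epow B := by
  induction A using runInduction with
  | nil => rfl
  | singleton a =>
    rcases B with _ | ⟨b, B⟩
    · rfl
    · exact epow_cons_cons_of_ne (h a rfl b rfl) B
  | cons_self a s ih =>
    obtain ⟨k, r, hr, hr'⟩ := epow_cons_cons_self a s
    have ih := ih ((runBoundary_append_left_iff [a] (by simp)).1 h)
    rw [hr, List.cons_append, List.cons_append] at ih
    rw [List.cons_append, List.cons_append, epow_cons_of_eq ih, hr', List.cons_append]
  | cons_ne a b s hab ih =>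
    have ih := ih ((runBoundary_append_left_iff [a] (by simp)).1 h)
    rw [List.cons_append, List.cons_append, epow_cons_cons_of_ne hab, ← List.cons_append, ih,
      epow_cons_cons_of_ne hab, List.cons_append]

theorem head?_replicate_append {a : ℕ} {s : List ℕ} (k : ℕ) (h : s.head? = some a) :
    (List.replicate k a ++ s).head? = some a := by
  cases k <;> simp [List.replicate_succ, h]

theorem length_epow_replicate_append {a : ℕ} {s : List ℕ} (k : ℕ) (h : s.head? = some a) :
    (epow (List.replicate k a ++ s)).length = (epow s).length := by
  induction k with
  | zero => rfl
  | succ k ih =>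
    obtain ⟨s', hs'⟩ := List.head?_eq_some_iff.1 (head?_replicate_append k h)
    rw [← ih, List.replicate_succ, List.cons_append, hs', length_epow_cons_cons, if_pos rfl,
      add_zero]

theorem length_epow_replicate_le (k a : ℕ) : (epow (List.replicate k a)).length ≤ 1 := by
  rcases k with _ | k
  · simp
  · rw [List.replicate_succ', length_epow_replicate_append k rfl, epow_singleton,
      List.length_singleton]

theorem length_epow_append_replicate {b : ℕ} {s : List ℕ} (k : ℕ) (h : s.getLast? = some b) :
    (epow (s ++ List.replicate k b)).length = (epow s).length := by
  induction s using runInduction with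
  | nil => simp at h
  | singleton a =>
    obtain rfl : a = b := by simpa using h
    rw [List.singleton_append, ← List.replicate_succ, List.replicate_succ',
      length_epow_replicate_append k rfl]
  | cons_self a s ih | cons_ne a b s _ ih =>
    have ih := ih (by simpa using h)
    rw [List.cons_append] at ih
    rw [List.cons_append, List.cons_append, length_epow_cons_cons, length_epow_cons_cons, ih]

theorem exists_eq_replicate_append (a : ℕ) (s : List ℕ) :
    ∃ k s', s = List.replicate k a ++ s' ∧ RunBoundary [a] s' := by
  refine ⟨(s.takeWhile (· == a)).length, s.dropWhile (· == a), ?_, ?_⟩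
  · rw [← List.eq_replicate_of_mem (a := a) (l := s.takeWhile (· == a)),
      List.takeWhile_append_dropWhile]
    exact fun b hb => by simpa using List.mem_takeWhile_imp hb
  · intro b hb c hc
    obtain rfl : a = b := by simpa using hb
    rintro rfl
    have := List.head?_dropWhile_not (· == a) s
    rw [Option.mem_def.1 hc] at this
    simp at this

theorem exists_eq_append_replicate (s : List ℕ) (a : ℕ) :
    ∃ s' k, s = s' ++ List.replicate k a ∧ RunBoundary s' [a] := by
  obtain ⟨k, s', hs, hs'⟩ := exists_eq_replicate_append a s.reverse
  exact ⟨s'.reverse, k, by simpa using congrArg List.reverse hs, hs'.reverse⟩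

/-- `E₂` are the runs that meet the part `X`. -/
theorem exists_epow_append_append (A C : List ℕ) {X : List ℕ} (hX : X ≠ []) :
    ∃ E₁ E₂ E₃, epow (A ++ X ++ C) = E₁ ++ E₂ ++ E₃ ∧ E₂.length ≤ (epow X).length ∧
      expand E₁ <+: A ∧ A ++ X <+: expand (E₁ ++ E₂) := by
  obtain ⟨a, ha⟩ := Option.ne_none_iff_exists'.1 (mt List.head?_eq_none_iff.1 hX)
  obtain ⟨b, hb⟩ := Option.ne_none_iff_exists'.1 (mt List.getLast?_eq_none_iff.1 hX)
  obtain ⟨A, i, rfl, hA⟩ := exists_eq_append_replicate A a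
  obtain ⟨j, C, rfl, hC⟩ := exists_eq_replicate_append b C
  set Y := List.replicate i a ++ (X ++ List.replicate j b) with hY
  have hleft : RunBoundary A (Y ++ C) := by
    have hhead : (Y ++ C).head? = some a := by
      simpa [hY] using head?_replicate_append i (s := X ++ (List.replicate j b ++ C)) (by simp [ha])
    simpa [RunBoundary, hhead] using hA
  have hright : RunBoundary Y C := by
    have hlast : Y.getLast? = some b := by
      rcases j with _ | j <;> simp [hY, List.replicate_succ', hb]
    simpa [RunBoundary, hlast] using hC
  refine ⟨epow A, epow Y, epow C, ?_, ?_, ?_, ?_⟩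
  · rw [List.append_assoc (epow A), ← epow_append hright, ← epow_append hleft]
    simp [hY]
  · rw [length_epow_replicate_append i (by simp [ha]), length_epow_append_replicate j hb]
  · simp [expand_epow]
  · simp [expand_epow, hY]

end SigEnc

namespace SigEnc

theorem exists_hatL_eq_replicate (s : List ℕ) : ∃ k a, hatL s = List.replicate k a :=
  ⟨_, s.headD 0, List.eq_replicate_of_mem fun b hb => by simpa using List.mem_takeWhile_imp hb⟩

theorem exists_hatR_eq_replicate (s : List ℕ) : ∃ k a, hatR s = List.replicate k a := by
  obtain ⟨k, a, h⟩ := exists_hatL_eq_replicate s.reverse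
  exact ⟨k, a, by rw [hatR, h, List.reverse_replicate]⟩

theorem length_epow_hatL_le (s : List ℕ) : (epow (hatL s)).length ≤ 1 := by
  obtain ⟨k, a, h⟩ := exists_hatL_eq_replicate s
  exact h ▸ length_epow_replicate_le k a

theorem length_epow_hatR_le (s : List ℕ) : (epow (hatR s)).length ≤ 1 := by
  obtain ⟨k, a, h⟩ := exists_hatR_eq_replicate s
  exact h ▸ length_epow_replicate_le k a

theorem hatL_ne_nil {s : List ℕ} (hs : s ≠ []) : hatL s ≠ [] := by
  obtain ⟨a, s, rfl⟩ := List.exists_cons_of_ne_nil hs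
  simp [hatL]

theorem hatR_ne_nil {s : List ℕ} (hs : s ≠ []) : hatR s ≠ [] := by
  simpa [hatR] using hatL_ne_nil (List.reverse_ne_nil_iff.2 hs)

theorem exists_eq_hatL_append (s : List ℕ) : ∃ r, s = hatL s ++ r ∧ RunBoundary (hatL s) r := by
  refine ⟨s.dropWhile (· == s.headD 0), List.takeWhile_append_dropWhile.symm, ?_⟩
  intro a ha b hb
  obtain rfl : a = s.headD 0 := by simpa using List.mem_takeWhile_imp (List.mem_of_getLast? ha)
  rintro rfl
  have := List.head?_dropWhile_not (· == s.headD 0) s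
  rw [Option.mem_def.1 hb] at this
  simp at this

theorem exists_eq_append_hatR (s : List ℕ) : ∃ r, s = r ++ hatR s ∧ RunBoundary r (hatR s) := by
  obtain ⟨r, hr, h⟩ := exists_eq_hatL_append s.reverse
  exact ⟨r.reverse, by simpa [hatR] using congrArg List.reverse hr, h.reverse⟩

theorem take_append_trim_append_drop {β : Type*} {a b : ℕ} {l : List β}
    (h : a + b ≤ l.length) : l.take a ++ trim a b l ++ l.drop (l.length - b) = l := by
  rw [trim, ← Nat.min_eq_left (show a ≤ l.length - b by omega), ← List.take_take,
    Nat.min_eq_left (show a ≤ l.length - b by omega), List.take_append_drop,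
    List.take_append_drop]

theorem trim_append {β : Type*} (A m B : List β) :
    trim A.length B.length (A ++ m ++ B) = m := by
  rw [trim, show (A ++ m ++ B).length - B.length = (A ++ m).length by simp; omega, List.take_left,
    List.drop_left]

theorem exists_eq_hatL_append_append_hatR {s : List ℕ} (hs : 3 ≤ (epow s).length) :
    ∃ m, s = hatL s ++ m ++ hatR s ∧ RunBoundary (hatL s) m ∧
      RunBoundary m (hatR s) ∧ m ≠ [] := by
  obtain ⟨r, hr, hbr⟩ := exists_eq_hatL_append s
  obtain ⟨r', hr', hbr'⟩ := exists_eq_append_hatR s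
  have hr_runs : 2 ≤ (epow r).length := by
    have := congrArg List.length (epow_append hbr)
    rw [← hr, List.length_append] at this
    have := length_epow_hatL_le s
    omega
  obtain ⟨k, b, hk⟩ := exists_hatR_eq_replicate s
  have hnot : ¬ r <:+ hatR s := by
    intro h
    rw [hk] at h
    rw [List.eq_replicate_of_mem fun x hx => List.eq_of_mem_replicate (h.subset hx)] at hr_runs
    have := length_epow_replicate_le r.length b
    omega
  obtain ⟨m, rfl⟩ := (List.suffix_or_suffix_of_suffix ⟨_, hr.symm⟩ ⟨_, hr'.symm⟩).resolve_left hnot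
  have hm : m ≠ [] := by
    rintro rfl
    exact hnot List.suffix_rfl
  obtain rfl : r' = hatL s ++ m := by
    apply List.append_cancel_right (bs := hatR s)
    rw [← hr', List.append_assoc, ← hr]
  exact ⟨m, hr', (runBoundary_append_right_iff _ hm).1 hbr,
    (runBoundary_append_left_iff _ hm).1 hbr', hm⟩

/-- `s` without its first and its last run. -/
def innerRuns (s : List ℕ) : List ℕ := trim (hatL s).length (hatR s).length s

theorem innerRuns_spec {s : List ℕ} (hs : 3 ≤ (epow s).length) :
    s = hatL s ++ innerRuns s ++ hatR s ∧ RunBoundary (hatL s) (innerRuns s) ∧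
      RunBoundary (innerRuns s) (hatR s) ∧ innerRuns s ≠ [] := by
  obtain ⟨m, hm, h⟩ := exists_eq_hatL_append_append_hatR hs
  have hinner : innerRuns s = m := by
    have := trim_append (hatL s) m (hatR s)
    rwa [← hm] at this
  rw [hinner]
  exact ⟨hm, h⟩

/-- The runs strictly inside `s` are runs of every sequence that contains `s`. -/
theorem epow_append_append_eq {s : List ℕ} (hs : 3 ≤ (epow s).length) (A C : List ℕ) :
    epow (A ++ s ++ C) = epow (A ++ hatL s) ++ epow (innerRuns s) ++ epow (hatR s ++ C) := by
  have hne : s ≠ [] := by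
    rintro rfl
    simp at hs
  obtain ⟨hsplit, hL, hR, hm⟩ := innerRuns_spec hs
  have hL' : RunBoundary (A ++ hatL s) (innerRuns s ++ (hatR s ++ C)) :=
    (runBoundary_append_right_iff _ hm).2
      ((runBoundary_append_left_iff _ (hatL_ne_nil hne)).2 hL)
  have hR' : RunBoundary (innerRuns s) (hatR s ++ C) :=
    (runBoundary_append_right_iff _ (hatR_ne_nil hne)).2 hR
  calc epow (A ++ s ++ C)
      = epow ((A ++ hatL s) ++ (innerRuns s ++ (hatR s ++ C))) := by
        conv_lhs => rw [hsplit]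
        simp only [List.append_assoc]
    _ = _ := by rw [epow_append hL', epow_append hR', List.append_assoc]

theorem length_epow_le_innerRuns {s : List ℕ} (hs : 3 ≤ (epow s).length) :
    (epow s).length ≤ (epow (innerRuns s)).length + 2 := by
  have h := congrArg List.length (epow_append_append_eq hs [] [])
  simp only [List.nil_append, List.append_nil, List.length_append] at h
  have := length_epow_hatL_le s
  have := length_epow_hatR_le s
  omega

/-! ### Blocks -/

theorem flatten_cut (l : List (ℕ × Bool)) : (cut l).flatten = l.map Prod.fst := by
  fun_induction cut l <;> simp_all

theorem cut_ne_nil {x : ℕ × Bool} {l : List (ℕ × Bool)} : cut (x :: l) ≠ [] := by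
  intro h
  simpa [h] using flatten_cut (x :: l)

theorem cut_append {A B : List (ℕ × Bool)} (h : ∀ b ∈ B.head?, b.2 = true) :
    cut (A ++ B) = cut A ++ cut B := by
  fun_induction cut A with
  | case1 => rfl
  | case2 x c =>
    rcases B with _ | ⟨⟨y, d⟩, B⟩
    · rfl
    · obtain rfl : d = true := h (y, d) rfl
      simp [cut]
  | case3 x c y l ih => simp_all [cut]
  | case4 x c y b l _ hq => exact absurd hq cut_ne_nil
  | case5 x c y b l hb q qs hq ih => simp_all [cut]

section withBits

variable {W : ℕ} {f : (Fin (logStar W + 11) → ℕ) → Bool}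

theorem map_fst_withBits (p : List ℕ) : (withBits f p).map Prod.fst = p := by
  rw [withBits, List.map_fst_zip]
  simp

theorem length_withBits (p : List ℕ) : (withBits f p).length = p.length := by
  simp [withBits]

theorem getElem?_withBits (p : List ℕ) (i : ℕ) :
    (withBits f p)[i]? = p[i]?.map fun x => (x, bit f p i) := by
  rcases lt_or_ge i p.length with h | h
  · simp [withBits, h]
  · rw [List.getElem?_eq_none h, List.getElem?_eq_none (h.trans' (length_withBits p).le)]
    rfl

theorem flatten_cut_trim_withBits (a b : ℕ) (p : List ℕ) :
    (cut (trim a b (withBits f p))).flatten = trim a b p := by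
  rw [flatten_cut, trim, List.map_drop, List.map_take, map_fst_withBits, length_withBits, trim]

theorem snd_of_mem_head?_drop_withBits {p : List ℕ} {i : ℕ} (h : bit f p i = true) :
    ∀ b ∈ ((withBits f p).drop i).head?, b.2 = true := by
  intro b hb
  rw [List.head?_drop, getElem?_withBits, Option.mem_def, Option.map_eq_some_iff] at hb
  obtain ⟨x, -, rfl⟩ := hb
  exact h

theorem flatten_eblock (p : List ℕ) : (eblock f p).flatten = p := by
  rw [eblock, flatten_cut, map_fst_withBits]

/-- The bits depend on a window only. -/
theorem bit_append_append (A C : List ℕ) {Q : List ℕ} {k : ℕ} (h1 : deltaL W ≤ k)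
    (h2 : k + 4 < Q.length) : bit f (A ++ Q ++ C) (A.length + k) = bit f Q k := by
  unfold bit
  congr 1
  funext j
  have hj := j.isLt
  have hd : deltaL W = logStar W + 6 := rfl
  rw [if_pos (by omega), if_pos (by omega),
    show A.length + k + j.val - deltaL W = A.length + (k + j.val - deltaL W) by omega,
    List.append_assoc, List.getD_append_right _ _ _ _ (by omega), Nat.add_sub_cancel_left,
    List.getD_append _ _ _ _ (by omega)]

theorem trim_withBits_append_append (A C : List ℕ) {Q : List ℕ} {a b : ℕ} (ha : deltaL W ≤ a)
    (hb : 5 ≤ b) :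
    trim (A.length + a) (b + C.length) (withBits f (A ++ Q ++ C)) = trim a b (withBits f Q) := by
  apply List.ext_getElem?
  intro j
  simp only [trim, List.getElem?_drop, List.getElem?_take, length_withBits, List.length_append,
    getElem?_withBits]
  by_cases hj : a + j < Q.length - b
  · rw [if_pos (by omega), if_pos hj, add_assoc, bit_append_append A C (by omega) (by omega),
      List.append_assoc, List.getElem?_append_right (by omega), Nat.add_sub_cancel_left,
      List.getElem?_append_left (by omega)]
  · rw [if_neg (by omega), if_neg hj]

/-- The blocks between `L` and `R` are blocks of every sequence that contains `Q`. -/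
theorem exists_eblock_append_append (A C : List ℕ) {Q : List ℕ} {a b : ℕ} (ha : deltaL W ≤ a)
    (hb : 5 ≤ b) (hab : a + b < Q.length) (hbit : bit f Q a = true)
    (hbit' : bit f Q (Q.length - b) = true) :
    ∃ U V, eblock f (A ++ Q ++ C) = U ++ cut (trim a b (withBits f Q)) ++ V ∧
      U.flatten = A ++ Q.take a ∧ V.flatten = Q.drop (Q.length - b) ++ C := by
  set p := A ++ Q ++ C with hp
  have hp' : p.length = A.length + Q.length + C.length := by simp [hp]; omega
  have hsplit := take_append_trim_append_drop (a := A.length + a) (b := b + C.length)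
    (l := withBits f p) (by rw [length_withBits]; omega)
  rw [trim_withBits_append_append A C ha hb, length_withBits,
    show p.length - (b + C.length) = A.length + (Q.length - b) by omega] at hsplit
  have hheadR : ∀ x ∈ ((withBits f p).drop (A.length + (Q.length - b))).head?, x.2 = true :=
    snd_of_mem_head?_drop_withBits (by rwa [bit_append_append A C (by omega) (by omega)])
  have hheadM : ∀ x ∈ (trim a b (withBits f Q)).head?, x.2 = true := by
    have hpre : trim a b (withBits f Q) <+: (withBits f Q).drop a :=
      (List.take_prefix _ _).drop a
    intro x hx
    obtain ⟨l, hl⟩ := List.head?_eq_some_iff.1 (Option.mem_def.1 hx)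
    obtain ⟨l', hl'⟩ := hpre
    exact snd_of_mem_head?_drop_withBits hbit x (by rw [← hl', hl]; rfl)
  refine ⟨cut ((withBits f p).take (A.length + a)),
    cut ((withBits f p).drop (A.length + (Q.length - b))), ?_, ?_, ?_⟩
  · rw [eblock, ← cut_append hheadM, ← cut_append hheadR, hsplit]
  · rw [flatten_cut, List.map_take, map_fst_withBits, hp, List.append_assoc,
      List.take_length_add_append, List.take_append_of_le_length (by omega)]
  · rw [flatten_cut, List.map_drop, map_fst_withBits, hp, List.append_assoc,
      List.drop_length_add_append, List.drop_append_of_le_length (by omega)]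

theorem IsLocallyConsistent.exists_bit_eq_true (hf : IsLocallyConsistent W f) {Q : List ℕ}
    (hQ : ∀ x ∈ Q, 1 ≤ x ∧ x ≤ W) (hc : Q.IsChain (· ≠ ·)) {i : ℕ} (hi : i + 4 < Q.length) :
    ∃ j, i ≤ j ∧ j ≤ i + 3 ∧ bit f Q j = true := by
  rcases (hf Q (by omega) hQ hc).2.2.2 i hi with h | h | h | h
  exacts [⟨_, by omega, by omega, h⟩, ⟨_, by omega, by omega, h⟩, ⟨_, by omega, by omega, h⟩,
    ⟨_, by omega, by omega, h⟩]

theorem lenL_spec (hf : IsLocallyConsistent W f) {Q : List ℕ} (hQ : ∀ x ∈ Q, 1 ≤ x ∧ x ≤ W)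
    (hc : Q.IsChain (· ≠ ·)) (hlen : deltaL W + 4 < Q.length) :
    deltaL W ≤ lenL f Q ∧ lenL f Q ≤ deltaL W + 3 ∧ bit f Q (lenL f Q) = true := by
  obtain ⟨l, hl, hl', hbit⟩ := hf.exists_bit_eq_true hQ hc hlen
  have hmem : l ∈ {l | deltaL W ≤ l ∧ l < Q.length ∧ bit f Q l = true} := ⟨hl, by omega, hbit⟩
  obtain ⟨h, -, h'⟩ := Nat.sInf_mem ⟨l, hmem⟩
  exact ⟨h, (Nat.sInf_le hmem).trans hl', h'⟩

theorem lenR_spec (hf : IsLocallyConsistent W f) {Q : List ℕ} (hQ : ∀ x ∈ Q, 1 ≤ x ∧ x ≤ W)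
    (hc : Q.IsChain (· ≠ ·)) (hlen : 8 ≤ Q.length) :
    5 ≤ lenR f Q ∧ lenR f Q ≤ 8 ∧ bit f Q (Q.length - lenR f Q) = true := by
  obtain ⟨j, hj, hj', hbit⟩ := hf.exists_bit_eq_true hQ hc (i := Q.length - 8) (by omega)
  have hmem : Q.length - j ∈
      {r | deltaR + 1 ≤ r ∧ r ≤ Q.length ∧ bit f Q (Q.length - r) = true} :=
    ⟨by simp only [deltaR]; omega, by omega, by rwa [Nat.sub_sub_self (by omega)]⟩
  obtain ⟨h, -, h'⟩ := Nat.sInf_mem ⟨_, hmem⟩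
  exact ⟨h, (Nat.sInf_le hmem).trans (by omega), h'⟩

end withBits

/-! ### The iterated logarithm -/

theorem exists_iterate_logb_le_one (n : ℕ) {x : ℝ} (hx : x ≤ n + 1) :
    ∃ k, (Real.logb 2)^[k] x ≤ 1 := by
  induction n generalizing x with
  | zero => exact ⟨0, by simpa using hx⟩
  | succ n ih =>
    rcases le_or_gt x 1 with h1 | h1
    · exact ⟨0, h1⟩
    have hlog : Real.logb 2 x ≤ n + 1 := by
      rw [Real.logb_le_iff_le_rpow (by norm_num) (by linarith)]
      have hpow : ((n + 1 + 1 : ℕ) : ℝ) ≤ (2 ^ (n + 1) : ℕ) := by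
        exact_mod_cast (n + 1).lt_two_pow_self
      exact_mod_cast hx.trans (by exact_mod_cast hpow)
    obtain ⟨k, hk⟩ := ih hlog
    exact ⟨k + 1, hk⟩

theorem one_le_logStar {n : ℕ} (hn : 2 ≤ n) : 1 ≤ logStar n := by
  have hmem : (Real.logb 2)^[logStar n] (n : ℝ) ≤ 1 :=
    Nat.sInf_mem (exists_iterate_logb_le_one n (by linarith))
  by_contra! h
  rw [Nat.lt_one_iff.1 h, Function.iterate_zero_apply, Nat.cast_le_one] at hmem
  omega

end SigEnc

namespace SigEnc.RLSLP

variable {α : Type*} {G : RLSLP α}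

/-! ### Sequences of consecutive nodes -/

/-- The derivation tree of `r` has nodes labelled by the entries of the given sequence that derive
consecutive parts of `val(r)` from the given position on. -/
def NodesAt (G : RLSLP α) (r : ℕ) : ℕ → List ℕ → Prop
  | _, [] => True
  | i, y :: Y => (∃ π, G.label r π = some y ∧ G.offset r π = i) ∧
      NodesAt G r (i + (G.val y).length) Y

theorem nodesAt_append {r i : ℕ} {Y Z : List ℕ} :
    NodesAt G r i (Y ++ Z) ↔ NodesAt G r i Y ∧ NodesAt G r (i + (G.valPlus Y).length) Z := by
  induction Y generalizing i with
  | nil => simp [NodesAt]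
  | cons y Y ih => simp [NodesAt, ih, and_assoc, add_assoc]

theorem NodesAt.of_label {r y i : ℕ} {π Z : List ℕ} (h : NodesAt G y i Z)
    (hπ : G.label r π = some y) : NodesAt G r (G.offset r π + i) Z := by
  induction Z generalizing i with
  | nil => trivial
  | cons z Z ih =>
    obtain ⟨⟨σ, hσ, rfl⟩, hZ⟩ := h
    refine ⟨⟨π ++ σ, (label_append hπ σ).trans hσ, offset_append hπ σ⟩, ?_⟩
    rw [add_assoc]
    exact ih hZ

/-- The sequence `Z` is read off along a cut through the derivation tree of `y`. -/
def Expands (G : RLSLP α) (y : ℕ) (Z : List ℕ) : Prop :=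
  NodesAt G y 0 Z ∧ G.valPlus Z = G.val y

theorem expands_self (y : ℕ) : Expands G y [y] := ⟨⟨⟨[], rfl, rfl⟩, trivial⟩, by simp⟩

theorem nodesAt_drop_children {y : ℕ} (n : ℕ) :
    NodesAt G y (G.valPlus ((G.children y).take n)).length ((G.children y).drop n) := by
  by_cases hn : n < (G.children y).length
  · have hz : (G.children y)[n]? = some (G.children y)[n] := List.getElem?_eq_getElem hn
    rw [List.drop_eq_getElem_cons hn]
    refine ⟨⟨[n], label_cons hz [], offset_cons hz []⟩, ?_⟩
    rw [← length_valPlus_take_succ hz]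
    exact nodesAt_drop_children (n + 1)
  · rw [List.drop_eq_nil_of_le (not_lt.1 hn)]
    trivial
termination_by (G.children y).length - n

theorem expands_children {y : ℕ} (h : G.children y ≠ []) : Expands G y (G.children y) :=
  ⟨nodesAt_drop_children 0, valPlus_children h⟩

theorem valPlus_flatten_of_expands {Y : List ℕ} {Zs : List (List ℕ)}
    (hZ : List.Forall₂ (fun Z y => Expands G y Z) Zs Y) :
    G.valPlus Zs.flatten = G.valPlus Y := by
  induction hZ with
  | nil => rfl
  | cons hZ _ ih => simp [ih, hZ.2]

theorem NodesAt.flatten {r i : ℕ} {Y : List ℕ} {Zs : List (List ℕ)} (h : NodesAt G r i Y)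
    (hZ : List.Forall₂ (fun Z y => Expands G y Z) Zs Y) : NodesAt G r i Zs.flatten := by
  induction hZ generalizing i with
  | nil => trivial
  | cons hZ _ ih =>
    obtain ⟨⟨π, hπ, rfl⟩, hY⟩ := h
    rw [List.flatten_cons, nodesAt_append, hZ.2]
    exact ⟨hZ.1.of_label hπ, ih hY⟩

theorem Expands.flatten {r : ℕ} {Y : List ℕ} {Zs : List (List ℕ)} (h : Expands G r Y)
    (hZ : List.Forall₂ (fun Z y => Expands G y Z) Zs Y) : Expands G r Zs.flatten :=
  ⟨h.1.flatten hZ, (valPlus_flatten_of_expands hZ).trans h.2⟩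

theorem expands_pair {x l r : ℕ} (h : G.rhs x = some (.pair l r)) : Expands G x [l, r] := by
  rw [← children_of_pair h]
  exact expands_children (by simp [children_of_pair h])

theorem expands_pow {x y k : ℕ} (h : G.rhs x = some (.pow y k)) :
    Expands G x (List.replicate k y) := by
  rw [← children_of_pow h]
  exact expands_children (List.ne_nil_of_mem (List.mem_of_getElem? (children_of_pow_zero h)))

theorem rhs_of_sig {x : Rhs α} {e : ℕ} (h : G.sig x = some e) : G.rhs e = some x := by
  unfold sig at h
  split_ifs at h with hx
  cases h
  exact hx.choose_spec

theorem sigBlock_cases {q : List ℕ} {x : ℕ} (h : G.sigBlock q = some x) :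
    (∃ a b, q = [a, b] ∧ G.rhs x = some (.pair a b)) ∨
    (∃ a b c u, q = [a, b, c] ∧ G.rhs u = some (.pair a b) ∧ G.rhs x = some (.pair u c)) ∨
    (∃ a b c d u v, q = [a, b, c, d] ∧ G.rhs u = some (.pair a b) ∧
      G.rhs v = some (.pair u c) ∧ G.rhs x = some (.pair v d)) := by
  match q, h with
  | [a, b], h => exact .inl ⟨a, b, rfl, rhs_of_sig h⟩
  | [a, b, c], h =>
    simp only [sigBlock, Option.bind_eq_some_iff] at h
    obtain ⟨u, hu, hx⟩ := h
    exact .inr (.inl ⟨a, b, c, u, rfl, rhs_of_sig hu, rhs_of_sig hx⟩)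
  | [a, b, c, d], h =>
    simp only [sigBlock, Option.bind_eq_some_iff] at h
    obtain ⟨u, hu, v, hv, hx⟩ := h
    exact .inr (.inr ⟨a, b, c, d, u, v, rfl, rhs_of_sig hu, rhs_of_sig hv, rhs_of_sig hx⟩)

theorem two_le_length_of_sigBlock {q : List ℕ} {x : ℕ} (h : G.sigBlock q = some x) :
    2 ≤ q.length := by
  rcases sigBlock_cases h with ⟨a, b, rfl, -⟩ | ⟨a, b, c, u, rfl, -⟩ |
    ⟨a, b, c, d, u, v, rfl, -⟩ <;> simp

theorem expands_of_sigBlock {q : List ℕ} {x : ℕ} (h : G.sigBlock q = some x) :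
    Expands G x q := by
  have extend {u v c : ℕ} {q : List ℕ} (hv : G.rhs v = some (.pair u c)) (hu : Expands G u q) :
      Expands G v [q, [c]].flatten :=
    (expands_pair hv).flatten (.cons hu (.cons (expands_self c) .nil))
  rcases sigBlock_cases h with ⟨a, b, rfl, hx⟩ | ⟨a, b, c, u, rfl, hu, hx⟩ |
    ⟨a, b, c, d, u, v, rfl, hu, hv, hx⟩
  · exact expands_pair hx
  · exact extend hx (expands_pair hu)
  · exact extend hx (extend hv (expands_pair hu))

theorem hasRank_of_sigBlock {q : List ℕ} {x t : ℕ} (h : G.sigBlock q = some x)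
    (hq : ∀ y ∈ q, HasRank G (4 * t + 1) y) :
    ∃ n, 4 * (t + 1) ≤ n + 2 ∧ n ≤ 4 * (t + 1) ∧ HasRank G n x := by
  rcases sigBlock_cases h with ⟨a, b, rfl, hx⟩ | ⟨a, b, c, u, rfl, hu, hx⟩ |
    ⟨a, b, c, d, u, v, rfl, hu, hv, hx⟩ <;>
    simp only [List.forall_mem_cons] at hq
  · obtain ⟨ha, hb, -⟩ := hq
    exact ⟨_, by omega, by omega, .pair hx le_rfl (by omega) ha hb⟩
  · obtain ⟨ha, hb, hc, -⟩ := hq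
    have hu := HasRank.pair hu le_rfl (by omega) ha hb
    exact ⟨_, by omega, by omega, .pair (j := 2) hx (by omega) (by omega) hu hc⟩
  · obtain ⟨ha, hb, hc, hd, -⟩ := hq
    have hu := HasRank.pair hu le_rfl (by omega) ha hb
    have hv := HasRank.pair (j := 2) hv (by omega) (by omega) hu hc
    exact ⟨_, by omega, by omega, .pair (j := 3) hx (by omega) (by omega) hv hd⟩

theorem expands_of_sigBlocks {q : List (List ℕ)} {s : List ℕ} (h : G.sigBlocks q = some s) :
    List.Forall₂ (fun Z y => Expands G y Z) q s :=
  (mapM_eq_some_iff.1 h).imp fun _ _ h => expands_of_sigBlock h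

theorem expands_of_sigRuns {q : List (ℕ × ℕ)} {p : List ℕ} (h : G.sigRuns q = some p) :
    List.Forall₂ (fun Z y => Expands G y Z) (q.map fun r => List.replicate r.2 r.1) p := by
  rw [List.forall₂_map_left_iff]
  exact (mapM_eq_some_iff.1 h).imp fun _ _ h => expands_pow (rhs_of_sig h)

theorem valPlus_of_sigRuns {q : List (ℕ × ℕ)} {p : List ℕ} (h : G.sigRuns q = some p) :
    G.valPlus p = G.valPlus (expand q) := by
  rw [← valPlus_flatten_of_expands (expands_of_sigRuns h), expand, List.flatMap]

theorem valPlus_of_sigBlocks {q : List (List ℕ)} {s : List ℕ} (h : G.sigBlocks q = some s) :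
    G.valPlus s = G.valPlus q.flatten :=
  (valPlus_flatten_of_expands (expands_of_sigBlocks h)).symm

theorem valPlus_of_sigChars {T : List α} {s : List ℕ} (h : G.sigChars T = some s) :
    G.valPlus s = T := by
  have h := mapM_eq_some_iff.1 h
  induction h with
  | nil => rfl
  | cons ha _ ih =>
    rw [valPlus_cons, ih (by rwa [sigChars, mapM_eq_some_iff]), val_of_char (rhs_of_sig ha)]
    rfl

/-! ### The layers of a signature encoding -/

variable {W : ℕ} {f : (Fin (logStar W + 11) → ℕ) → Bool} {T : List α}

theorem pow_eq_some {t : ℕ} {p : List ℕ} (h : G.pow f T t = some p) :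
    ∃ s, G.shrink f T t = some s ∧ G.sigRuns (epow s) = some p := by
  simpa only [pow, Option.bind_eq_some_iff] using h

theorem shrink_succ_eq_some {t : ℕ} {s : List ℕ} (h : G.shrink f T (t + 1) = some s) :
    ∃ p, G.pow f T t = some p ∧ G.sigBlocks (eblock f p) = some s := by
  simp only [shrink, Option.bind_eq_some_iff] at h
  obtain ⟨s', hs', p, hp, h⟩ := h
  exact ⟨p, by simp [pow, hs', hp], h⟩

theorem hasRank_of_sigRuns {t : ℕ} {s p : List ℕ}
    (hs : ∀ x ∈ s, ∃ n, 4 * t ≤ n + 2 ∧ n ≤ 4 * t ∧ HasRank G n x)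
    (h : G.sigRuns (epow s) = some p) : ∀ x ∈ p, HasRank G (4 * t + 1) x := by
  intro x hx
  obtain ⟨r, hr, hrx⟩ := exists_mem_left_of_mapM h hx
  obtain ⟨n, hn, hn', hrank⟩ := hs r.1 (mem_of_mem_epow hr)
  exact .run (rhs_of_sig hrx) hn hn' hrank

theorem hasRank_of_shrink {t : ℕ} {s : List ℕ} (h : G.shrink f T t = some s) :
    ∀ x ∈ s, ∃ n, 4 * t ≤ n + 2 ∧ n ≤ 4 * t ∧ HasRank G n x := by
  induction t generalizing s with
  | zero =>
    intro x hx
    obtain ⟨a, -, ha⟩ := exists_mem_left_of_mapM h hx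
    exact ⟨0, by omega, by omega, .char (rhs_of_sig ha)⟩
  | succ t ih =>
    obtain ⟨p, hp, hs⟩ := shrink_succ_eq_some h
    obtain ⟨s', hs', hsp⟩ := pow_eq_some hp
    have hp := hasRank_of_sigRuns (ih hs') hsp
    intro x hx
    obtain ⟨q, hq, hqx⟩ := exists_mem_left_of_mapM hs hx
    refine hasRank_of_sigBlock hqx fun y hy => hp y ?_
    rw [← flatten_eblock (f := f) p]
    exact List.mem_flatten.2 ⟨q, hq, hy⟩

theorem hasRank_of_pow {t : ℕ} {p : List ℕ} (h : G.pow f T t = some p) :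
    ∀ x ∈ p, HasRank G (4 * t + 1) x := by
  obtain ⟨s, hs, hp⟩ := pow_eq_some h
  exact hasRank_of_sigRuns (hasRank_of_shrink hs) hp

theorem valPlus_of_shrink {t : ℕ} {s : List ℕ} (h : G.shrink f T t = some s) :
    G.valPlus s = T := by
  induction t generalizing s with
  | zero => exact valPlus_of_sigChars h
  | succ t ih =>
    obtain ⟨p, hp, hs⟩ := shrink_succ_eq_some h
    obtain ⟨s', hs', hsp⟩ := pow_eq_some hp
    rw [valPlus_of_sigBlocks hs, flatten_eblock, valPlus_of_sigRuns hsp, expand_epow, ih hs']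

theorem valPlus_of_pow {t : ℕ} {p : List ℕ} (h : G.pow f T t = some p) : G.valPlus p = T := by
  obtain ⟨s, hs, hp⟩ := pow_eq_some h
  rw [valPlus_of_sigRuns hp, expand_epow, valPlus_of_shrink hs]

theorem NodesAt.of_sigRuns {r : ℕ} {s p : List ℕ} (hp : NodesAt G r 0 p)
    (h : G.sigRuns (epow s) = some p) : NodesAt G r 0 s := by
  have := hp.flatten (expands_of_sigRuns h)
  rwa [← List.flatMap_def, ← expand, expand_epow] at this

theorem exists_layers_of_pow {H t r : ℕ} {p₀ : List ℕ} (h : G.pow f T H = some p₀)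
    (hp₀ : NodesAt G r 0 p₀) (ht : t ≤ H) :
    ∃ s p, G.shrink f T t = some s ∧ G.pow f T t = some p ∧ G.sigRuns (epow s) = some p ∧
      NodesAt G r 0 s ∧ NodesAt G r 0 p := by
  induction H generalizing p₀ with
  | zero =>
    obtain rfl : t = 0 := by omega
    obtain ⟨s, hs, hsp⟩ := pow_eq_some h
    exact ⟨s, p₀, hs, h, hsp, hp₀.of_sigRuns hsp, hp₀⟩
  | succ H ih =>
    obtain ⟨s, hs, hsp⟩ := pow_eq_some h
    have hnodes := hp₀.of_sigRuns hsp
    rcases ht.eq_or_lt with rfl | ht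
    · exact ⟨s, p₀, hs, h, hsp, hnodes, hp₀⟩
    · obtain ⟨p, hp, hps⟩ := shrink_succ_eq_some hs
      refine ih hp ?_ (by omega)
      rw [← flatten_eblock (f := f) p]
      exact hnodes.flatten (expands_of_sigBlocks hps)

/-! ### Counting runs -/

theorem countIn_runStarts_le_one {r t x : ℕ} {π : List ℕ} (hπ : G.label r π = some x)
    (hx : HasRank G (4 * t + 1) x) :
    countIn (G.runStarts r t) (G.offset r π) (G.offset r π + (G.val x).length) ≤ 1 := by
  rw [← Set.ncard_singleton (G.offset r π)]
  refine Set.ncard_le_ncard ?_ (Set.finite_singleton _)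
  rintro o ⟨⟨σ, y, hσ, hy, rfl⟩, hle, hlt⟩
  have := hy.length_val_pos
  rw [hx.eq_of_overlap hy hπ hσ (by omega) hlt]
  rfl

theorem countIn_runStarts_le_length {r t a : ℕ} {Q : List ℕ} (h : NodesAt G r a Q)
    (hQ : ∀ x ∈ Q, HasRank G (4 * t + 1) x) :
    countIn (G.runStarts r t) a (a + (G.valPlus Q).length) ≤ Q.length := by
  induction Q generalizing a with
  | nil => simp [countIn_of_le]
  | cons x Q ih =>
    obtain ⟨⟨π, hπ, rfl⟩, hQx⟩ := h
    rw [List.forall_mem_cons] at hQ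
    have hhead := countIn_runStarts_le_one hπ hQ.1
    have htail := ih hQx hQ.2
    have := countIn_le_add (G.runStarts r t) (G.offset r π) (G.offset r π + (G.val x).length)
      (G.offset r π + (G.valPlus (x :: Q)).length)
    rw [valPlus_cons, List.length_append, ← add_assoc] at this ⊢
    rw [List.length_cons]
    omega

theorem countIn_runStarts_le_length_epow {r t : ℕ} {A X C p : List ℕ}
    (h : G.sigRuns (epow (A ++ X ++ C)) = some p) (hp : NodesAt G r 0 p)
    (hr : ∀ x ∈ p, HasRank G (4 * t + 1) x) :
    countIn (G.runStarts r t) (G.valPlus A).length (G.valPlus (A ++ X)).length ≤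
      (epow X).length := by
  rcases eq_or_ne X [] with rfl | hX
  · simp [countIn_of_le]
  obtain ⟨E₁, E₂, E₃, hE, hlen, hA, hAX⟩ := exists_epow_append_append A C hX
  rw [hE, sigRuns, mapM_append_eq_some_iff] at h
  obtain ⟨Q, Q₃, hQ, -, rfl⟩ := h
  obtain ⟨Q₁, Q₂, hQ₁, hQ₂, rfl⟩ := mapM_append_eq_some_iff.1 hQ
  have hA := length_valPlus_le_of_prefix (G := G) hA
  have hAX := length_valPlus_le_of_prefix (G := G) hAX
  rw [← valPlus_of_sigRuns hQ₁] at hA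
  rw [← valPlus_of_sigRuns hQ, valPlus_append (x := Q₁), List.length_append] at hAX
  rw [nodesAt_append, nodesAt_append, zero_add] at hp
  calc countIn (G.runStarts r t) (G.valPlus A).length (G.valPlus (A ++ X)).length
      ≤ countIn (G.runStarts r t) (G.valPlus Q₁).length
          ((G.valPlus Q₁).length + (G.valPlus Q₂).length) := countIn_mono _ hA hAX
    _ ≤ Q₂.length := countIn_runStarts_le_length hp.1.2 fun x hx => hr x (by simp [hx])
    _ ≤ (epow X).length := (length_eq_of_mapM_eq_some hQ₂).ge.trans hlen

end SigEnc.RLSLP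

namespace SigEnc

theorem two_mul_length_le_length_flatten {β : Type*} {q : List (List β)}
    (h : ∀ b ∈ q, 2 ≤ b.length) : 2 * q.length ≤ q.flatten.length := by
  induction q with
  | nil => simp
  | cons b q ih =>
    rw [List.forall_mem_cons] at h
    have := ih h.2
    simp only [List.flatten_cons, List.length_cons, List.length_append]
    omega

namespace RLSLP

variable {α : Type*} {G : RLSLP α}

/-! ### One round of the construction of the common sequence -/

theorem isChain_of_sigRuns {q : List (ℕ × ℕ)} {p : List ℕ} (h : G.sigRuns q = some p)
    (hq : q.IsChain fun r r' => r.1 ≠ r'.1) : p.IsChain (· ≠ ·) := by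
  have h := mapM_eq_some_iff.1 h
  clear * - h hq
  induction h with
  | nil => simp
  | cons hx htail ih =>
    cases htail with
    | nil => simp
    | cons hy _ =>
      obtain ⟨hne, hq⟩ := List.isChain_cons_cons.1 hq
      refine List.isChain_cons_cons.2 ⟨?_, ih hq⟩
      rintro rfl
      have heq := (rhs_of_sig hx).symm.trans (rhs_of_sig hy)
      exact hne (Rhs.pow.inj (Option.some.inj heq)).1

theorem exists_xpowStep {A X C p : List ℕ} (hX : 3 ≤ (epow X).length)
    (hp : G.sigRuns (epow (A ++ X ++ C)) = some p) :
    ∃ B Q D, p = B ++ Q ++ D ∧ G.xpowStep X = some Q ∧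
      G.valPlus B = G.valPlus (A ++ hatL X) ∧ G.valPlus Q = G.valPlus (innerRuns X) ∧
      Q.length = (epow (innerRuns X)).length ∧ Q.IsChain (· ≠ ·) := by
  rw [epow_append_append_eq hX, sigRuns, mapM_append_eq_some_iff] at hp
  obtain ⟨BQ, D, hBQ, -, rfl⟩ := hp
  obtain ⟨B, Q, hB, hQ, rfl⟩ := mapM_append_eq_some_iff.1 hBQ
  exact ⟨B, Q, D, rfl, hQ, by rw [valPlus_of_sigRuns hB, expand_epow],
    by rw [valPlus_of_sigRuns hQ, expand_epow], (length_eq_of_mapM_eq_some hQ).symm,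
    isChain_of_sigRuns hQ (isChain_epow _)⟩

variable {M : ℕ} {f : (Fin (logStar M + 11) → ℕ) → Bool} {T : List α}

theorem exists_xshrinkStep (hf : IsLocallyConsistent M f) {B Q D s : List ℕ}
    (hQ : ∀ x ∈ Q, 1 ≤ x ∧ x ≤ M) (hQc : Q.IsChain (· ≠ ·)) (hlen : deltaL M + 12 ≤ Q.length)
    (hs : G.sigBlocks (eblock f (B ++ Q ++ D)) = some s) :
    ∃ A X C, s = A ++ X ++ C ∧ G.xshrinkStep f Q = some X ∧
      G.valPlus A = G.valPlus (B ++ Q.take (lenL f Q)) ∧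
      G.valPlus X = G.valPlus (trim (lenL f Q) (lenR f Q) Q) ∧
      X ≠ [] ∧ 2 * X.length ≤ Q.length := by
  obtain ⟨hL, hL', hbitL⟩ := lenL_spec hf hQ hQc (by omega)
  obtain ⟨hR, hR', hbitR⟩ := lenR_spec hf hQ hQc (by omega)
  obtain ⟨U, V, hUV, hU, -⟩ :=
    exists_eblock_append_append B D hL hR (by omega) hbitL hbitR
  rw [hUV, sigBlocks, mapM_append_eq_some_iff] at hs
  obtain ⟨AX, C, hAX, -, rfl⟩ := hs
  obtain ⟨A, X, hA, hX, rfl⟩ := mapM_append_eq_some_iff.1 hAX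
  have hflat := flatten_cut_trim_withBits (f := f) (lenL f Q) (lenR f Q) Q
  have hXlen := length_eq_of_mapM_eq_some hX
  have htrim : (trim (lenL f Q) (lenR f Q) Q).length = Q.length - lenR f Q - lenL f Q := by
    simp only [trim, List.length_drop, List.length_take]
    omega
  have htwo : 2 * X.length ≤ (trim (lenL f Q) (lenR f Q) Q).length := by
    rw [← hflat, ← hXlen]
    refine two_mul_length_le_length_flatten fun b hb => ?_
    obtain ⟨x, -, hx⟩ := exists_mem_right_of_mapM hX hb
    exact two_le_length_of_sigBlock hx
  refine ⟨A, X, C, rfl, hX, by rw [valPlus_of_sigBlocks hA, hU],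
    by rw [valPlus_of_sigBlocks hX, hflat], ?_, by omega⟩
  rintro rfl
  rw [List.length_nil, List.length_eq_zero_iff] at hXlen
  rw [← hflat, hXlen, List.flatten_nil, List.length_nil] at htrim
  omega

/-- The node `π` of the derivation tree of `r`, with label `y`, is an element of the layer to which
it belongs: all nodes strictly above it are of higher rank than the elements of the `Shrink` layer
of its level. This rules out that it is the proper prefix of a block. -/
def Anchored (G : RLSLP α) (r y : ℕ) (π : List ℕ) : Prop :=
  ∀ σ z n, σ <+: π → σ ≠ π → G.label r σ = some z → HasRank G n z → 4 * G.level y < n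

/-- The derivation tree of `r` has anchored nodes labelled by the entries of the given sequence that
derive consecutive parts of `val(r)` from the given position on. -/
def AnchoredAt (G : RLSLP α) (r : ℕ) : ℕ → List ℕ → Prop
  | _, [] => True
  | i, y :: Y => (∃ π, G.label r π = some y ∧ G.offset r π = i ∧ Anchored G r y π) ∧
      AnchoredAt G r (i + (G.val y).length) Y

theorem anchoredAt_append {r i : ℕ} {Y Z : List ℕ} :
    AnchoredAt G r i (Y ++ Z) ↔
      AnchoredAt G r i Y ∧ AnchoredAt G r (i + (G.valPlus Y).length) Z := by
  induction Y generalizing i with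
  | nil => simp [AnchoredAt]
  | cons y Y ih => simp [AnchoredAt, ih, and_assoc, add_assoc]

theorem AnchoredAt.exists_label {r i j x : ℕ} {Y : List ℕ} (h : AnchoredAt G r i Y)
    (hj : Y[j]? = some x) : ∃ π, G.label r π = some x ∧
      G.offset r π = i + (G.valPlus (Y.take j)).length ∧ Anchored G r x π := by
  obtain ⟨hlt, rfl⟩ := List.getElem?_eq_some_iff.1 hj
  rw [← List.take_append_drop j Y, anchoredAt_append, List.drop_eq_getElem_cons hlt] at h
  exact h.2.1

theorem AnchoredAt.replace {r i : ℕ} {Y Y' Z Z' : List ℕ} (h : AnchoredAt G r i (Y ++ Z ++ Y'))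
    (hZ' : AnchoredAt G r (i + (G.valPlus Y).length) Z') (hval : G.valPlus Z' = G.valPlus Z) :
    AnchoredAt G r i (Y ++ Z' ++ Y') := by
  rw [anchoredAt_append, anchoredAt_append] at h ⊢
  refine ⟨⟨h.1.1, hZ'⟩, ?_⟩
  simpa only [valPlus_append, hval] using h.2

theorem HasRank.le_of_prefix {r x y m n : ℕ} {σ π : List ℕ} (hx : HasRank G m x)
    (hy : HasRank G n y) (hσ : G.label r σ = some x) (hπ : G.label r π = some y)
    (h : σ <+: π) : n ≤ m := by
  obtain ⟨τ, rfl⟩ := h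
  rw [label_append hσ] at hπ
  obtain ⟨k, hk, hkm⟩ := hx.exists_of_label hπ
  rw [hy.unique hk]
  rcases eq_or_ne τ [] with rfl | hτ
  · cases hπ
    exact (hk.unique hx).le
  · exact (hkm hτ).le

theorem NodesAt.anchoredAt {r i t : ℕ} {Y : List ℕ} (h : NodesAt G r i Y)
    (hY : ∀ y ∈ Y, HasRank G (4 * t + 1) y) : AnchoredAt G r i Y := by
  induction Y generalizing i with
  | nil => trivial
  | cons y Y ih =>
    obtain ⟨⟨π, hπ, hi⟩, hnodes⟩ := h
    rw [List.forall_mem_cons] at hY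
    refine ⟨⟨π, hπ, hi, fun σ z n hσπ _ hσ hz => ?_⟩, ih hnodes hY.2⟩
    have := hz.le_of_prefix hY.1 hσ hπ hσπ
    have := hY.1.level_eq
    omega

theorem anchored_concat {r t y b k : ℕ} {π : List ℕ} (hπ : G.label r π = some y)
    (hy : HasRank G (4 * t + 1) y) (hb : G.rhs y = some (.pow b k)) (m : ℕ) :
    Anchored G r b (π ++ [m]) := by
  intro σ z n hσπ hne hσ hz
  have hσπ := (List.prefix_concat_iff.1 hσπ).resolve_left hne
  have := hz.le_of_prefix hy hσ hπ hσπ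
  have := hy.level_eq
  have := level_of_pow hb
  omega

theorem anchoredAt_replicate {r t y b k m n : ℕ} {π : List ℕ} (hπ : G.label r π = some y)
    (hy : HasRank G (4 * t + 1) y) (hb : G.rhs y = some (.pow b k)) (hk : m + n = k) :
    AnchoredAt G r (G.offset r π + m * (G.val b).length) (List.replicate n b) := by
  induction n generalizing m with
  | zero => trivial
  | succ n ih =>
    have hchild : (G.children y)[m]? = some b := by
      rw [children_of_pow hb, List.getElem?_replicate_of_lt (by omega)]
    refine ⟨⟨π ++ [m], (label_append hπ _).trans (label_cons hchild []), ?_,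
      anchored_concat hπ hy hb m⟩, ?_⟩
    · rw [offset_append hπ, offset_cons hchild, children_of_pow hb, List.take_replicate,
        min_eq_left (by omega), valPlus_replicate]
      simp
    · simpa only [add_mul, one_mul, add_assoc] using ih (m := m + 1) (by omega)

theorem anchoredAt_expand {r t i : ℕ} {q : List (ℕ × ℕ)} {p : List ℕ}
    (h : G.sigRuns q = some p) (hp : NodesAt G r i p)
    (hr : ∀ x ∈ p, HasRank G (4 * t + 1) x) : AnchoredAt G r i (expand q) := by
  have h := mapM_eq_some_iff.1 h
  clear * - h hp hr
  induction h generalizing i with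
  | nil => trivial
  | cons hx _ ih =>
    obtain ⟨⟨π, hπ, rfl⟩, hp⟩ := hp
    rw [List.forall_mem_cons] at hr
    have hrhs := rhs_of_sig hx
    rw [expand_cons, anchoredAt_append, valPlus_replicate, ← val_of_pow hrhs]
    exact ⟨by simpa using anchoredAt_replicate hπ hr.1 hrhs (zero_add _), ih hp hr.2⟩

theorem anchoredAt_of_sigRuns {r t : ℕ} {s p : List ℕ} (h : G.sigRuns (epow s) = some p)
    (hp : NodesAt G r 0 p) (hr : ∀ x ∈ p, HasRank G (4 * t + 1) x) : AnchoredAt G r 0 s := by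
  simpa only [expand_epow] using anchoredAt_expand h hp hr

theorem nodesAt_start (G : RLSLP α) : NodesAt G G.start 0 [G.start] :=
  ⟨⟨[], rfl, rfl⟩, trivial⟩

theorem anchoredAt_of_shrink {H t : ℕ} (hH : G.pow f T H = some [G.start]) (ht : t ≤ H)
    {s : List ℕ} (hs : G.shrink f T t = some s) : AnchoredAt G G.start 0 s := by
  obtain ⟨s', p, hs', hp, hsp, -, hnodes⟩ := exists_layers_of_pow hH (nodesAt_start G) ht
  obtain rfl := Option.some.inj (hs.symm.trans hs')
  exact anchoredAt_of_sigRuns hsp hnodes (hasRank_of_pow hp)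

theorem countIn_runStarts_hatL_le_one {r t : ℕ} {A X C p : List ℕ}
    (h : G.sigRuns (epow (A ++ X ++ C)) = some p) (hp : NodesAt G r 0 p)
    (hr : ∀ x ∈ p, HasRank G (4 * t + 1) x) :
    countIn (G.runStarts r t) (G.valPlus A).length (G.valPlus (A ++ hatL X)).length ≤ 1 := by
  obtain ⟨Y, hY, -⟩ := exists_eq_hatL_append X
  refine (countIn_runStarts_le_length_epow (C := Y ++ C) ?_ hp hr).trans (length_epow_hatL_le X)
  rw [← h, ← List.append_assoc (A ++ hatL X), List.append_assoc A (hatL X), ← hY]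

theorem countIn_runStarts_hatR_le_one {r t : ℕ} {A X Y C p : List ℕ}
    (h : G.sigRuns (epow (A ++ X ++ C)) = some p) (hp : NodesAt G r 0 p)
    (hr : ∀ x ∈ p, HasRank G (4 * t + 1) x) (hX : X = Y ++ hatR X) :
    countIn (G.runStarts r t) (G.valPlus (A ++ Y)).length (G.valPlus (A ++ X)).length ≤ 1 := by
  have := countIn_runStarts_le_length_epow (A := A ++ Y) (X := hatR X) (C := C)
    (by rw [← h, List.append_assoc A Y, ← hX]) hp hr
  rw [List.append_assoc A Y, ← hX] at this
  exact this.trans (length_epow_hatR_le X)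

end RLSLP

end SigEnc

namespace SigEnc

namespace RLSLP

variable {α : Type*} {G : RLSLP α} {M : ℕ} {f : (Fin (logStar M + 11) → ℕ) → Bool} {T P : List α}

/-- The part `L̂ L` that a round of the construction of the common sequence splits off on the left,
where `X` is `XShrink_t` and `Q` is `XPow_t`. -/
noncomputable def cutL (f : (Fin (logStar M + 11) → ℕ) → Bool) (X Q : List ℕ) : List ℕ :=
  hatL X ++ Q.take (lenL f Q)

/-- The part `R R̂` that a round of the construction of the common sequence splits off on the right,
where `X` is `XShrink_t` and `Q` is `XPow_t`. -/
noncomputable def cutR (f : (Fin (logStar M + 11) → ℕ) → Bool) (X Q : List ℕ) : List ℕ :=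
  Q.drop (Q.length - lenR f Q) ++ hatR X

/-- Round `t` of the construction of the common sequence, carried out on a factor `X` of
`Shrink_t = A X C`: the factor `Q` of `Pow_t = B Q D` and the factor `X'` of
`Shrink_{t+1} = A' X' C'` are computed from `X` alone and derive the same parts of the string as
`X` and `Q` without the entries that are cut off. -/
structure Round (G : RLSLP α) (f : (Fin (logStar M + 11) → ℕ) → Bool) (T : List α) (t : ℕ)
    (A X C B Q D A' X' C' : List ℕ) : Prop where
  shrink : G.shrink f T t = some (A ++ X ++ C)
  sigRuns : G.sigRuns (epow (A ++ X ++ C)) = some (B ++ Q ++ D)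
  nodes : NodesAt G G.start 0 (B ++ Q ++ D)
  shrink_succ : G.shrink f T (t + 1) = some (A' ++ X' ++ C')
  anchored_succ : AnchoredAt G G.start 0 (A' ++ X' ++ C')
  xpowStep : G.xpowStep X = some Q
  xshrinkStep : G.xshrinkStep f Q = some X'
  three_le : 3 ≤ (epow X).length
  le_length : deltaL M + 12 ≤ Q.length
  lenL_le : lenL f Q ≤ deltaL M + 3
  lenR_le : lenR f Q ≤ 8
  ne_nil : X' ≠ []
  two_mul_length_le : 2 * X'.length ≤ X.length
  valPlus_left : G.valPlus B = G.valPlus (A ++ hatL X)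
  valPlus_mid : G.valPlus Q = G.valPlus (innerRuns X)
  valPlus_left' : G.valPlus A' = G.valPlus (B ++ Q.take (lenL f Q))
  valPlus_mid' : G.valPlus X' = G.valPlus (trim (lenL f Q) (lenR f Q) Q)

theorem lt_of_two_le_length_pow {H t : ℕ} {x : ℕ} {p : List ℕ} (hH : G.pow f T H = some [x])
    (ht : t ≤ H) (hp : G.pow f T t = some p) (h : 2 ≤ p.length) : t < H := by
  refine lt_of_le_of_ne ht ?_
  rintro rfl
  rw [hp, Option.some.injEq] at hH
  simp [hH] at h

theorem exists_round (hf : IsLocallyConsistent M f) (hM : ∀ x ∈ G.vars, x ≤ M) {H t : ℕ}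
    (hH : G.pow f T H = some [G.start]) (ht : t ≤ H) {A X C : List ℕ}
    (hs : G.shrink f T t = some (A ++ X ++ C)) (hX : deltaL M + 14 ≤ (epow X).length) :
    t < H ∧ ∃ B Q D A' X' C', Round G f T t A X C B Q D A' X' C' := by
  have hthree : 3 ≤ (epow X).length := by omega
  obtain ⟨s, p, hs', hp, hsp, -, hnodes⟩ := exists_layers_of_pow hH (nodesAt_start G) ht
  obtain rfl := Option.some.inj (hs.symm.trans hs')
  obtain ⟨B, Q, D, rfl, hQ, hB, hQX, hlen, hchain⟩ := exists_xpowStep hthree hsp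
  have hepow := length_epow_le_innerRuns hthree
  have hlt : t < H := lt_of_two_le_length_pow hH ht hp (by simp only [List.length_append]; omega)
  obtain ⟨s', -, hs', -, -, -, -⟩ := exists_layers_of_pow hH (nodesAt_start G) hlt
  obtain ⟨p, hp', hsp'⟩ := shrink_succ_eq_some hs'
  obtain rfl := Option.some.inj (hp.symm.trans hp')
  have hvars : ∀ x ∈ Q, 1 ≤ x ∧ x ≤ M := fun x hx =>
    have hx := (hasRank_of_pow hp x (by simp [hx])).mem_vars
    ⟨G.var_pos x hx, hM x hx⟩
  obtain ⟨A', X', C', rfl, hX', hA', hval, hne, htwo⟩ :=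
    exists_xshrinkStep hf hvars hchain (by omega) hsp'
  have hinner : Q.length ≤ X.length := by
    have := length_epow_le (innerRuns X)
    have := congrArg List.length (innerRuns_spec hthree).1
    simp only [List.length_append] at this
    omega
  exact ⟨hlt, B, Q, D, A', X', C',
    { shrink := hs, sigRuns := hsp, nodes := hnodes, shrink_succ := hs'
      anchored_succ := anchoredAt_of_shrink hH hlt hs'
      xpowStep := hQ, xshrinkStep := hX', three_le := hthree, le_length := by omega
      lenL_le := (lenL_spec hf hvars hchain (by omega)).2.1
      lenR_le := (lenR_spec hf hvars hchain (by omega)).2.1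
      ne_nil := hne, two_mul_length_le := htwo.trans hinner, valPlus_left := hB
      valPlus_mid := hQX, valPlus_left' := hA', valPlus_mid' := hval }⟩

namespace Round

variable {t : ℕ} {A X C B Q D A' X' C' : List ℕ}

theorem hasRank (h : Round G f T t A X C B Q D A' X' C') :
    ∀ x ∈ B ++ Q ++ D, HasRank G (4 * t + 1) x :=
  hasRank_of_sigRuns (hasRank_of_shrink h.shrink) h.sigRuns

theorem append_trim_append (h : Round G f T t A X C B Q D A' X' C') :
    Q.take (lenL f Q) ++ trim (lenL f Q) (lenR f Q) Q ++ Q.drop (Q.length - lenR f Q) = Q := by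
  have := h.lenL_le
  have := h.lenR_le
  have := h.le_length
  exact take_append_trim_append_drop (by omega)

theorem valPlus_take_append (h : Round G f T t A X C B Q D A' X' C') :
    G.valPlus (Q.take (lenL f Q) ++ X' ++ Q.drop (Q.length - lenR f Q)) =
      G.valPlus (innerRuns X) := by
  simp only [← h.valPlus_mid, valPlus_append, h.valPlus_mid']
  simp only [← valPlus_append, h.append_trim_append]

theorem valPlus_eq (h : Round G f T t A X C B Q D A' X' C') :
    G.valPlus (cutL f X Q ++ X' ++ cutR f X Q) = G.valPlus X := by
  conv_rhs => rw [(innerRuns_spec h.three_le).1]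
  have := h.valPlus_take_append
  simp only [valPlus_append] at this ⊢
  simp only [← this, cutL, cutR, valPlus_append, List.append_assoc]

theorem valPlus_append_cutL (h : Round G f T t A X C B Q D A' X' C') :
    G.valPlus A' = G.valPlus (A ++ cutL f X Q) := by
  rw [h.valPlus_left', valPlus_append, h.valPlus_left, cutL, ← List.append_assoc,
    valPlus_append (A ++ hatL X)]

theorem anchoredAt (h : Round G f T t A X C B Q D A' X' C') :
    AnchoredAt G G.start (G.valPlus A).length (cutL f X Q ++ X' ++ cutR f X Q) := by
  have hX : AnchoredAt G G.start (G.valPlus A).length (hatL X ++ innerRuns X ++ hatR X) := by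
    rw [← (innerRuns_spec h.three_le).1]
    have := anchoredAt_of_sigRuns h.sigRuns h.nodes h.hasRank
    rw [anchoredAt_append, anchoredAt_append, zero_add] at this
    exact this.1.2
  have hQ : AnchoredAt G G.start (G.valPlus B).length Q := by
    have := h.nodes.anchoredAt h.hasRank
    rw [anchoredAt_append, anchoredAt_append, zero_add] at this
    exact this.1.2
  have hX' : AnchoredAt G G.start (G.valPlus A').length X' := by
    have := h.anchored_succ
    rw [anchoredAt_append, anchoredAt_append, zero_add] at this
    exact this.1.2
  rw [← h.append_trim_append] at hQ
  rw [h.valPlus_left', valPlus_append, List.length_append] at hX'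
  have hinner := hQ.replace hX' h.valPlus_mid'
  rw [h.valPlus_left, valPlus_append, List.length_append] at hinner
  simpa only [cutL, cutR, List.append_assoc] using hX.replace hinner h.valPlus_take_append

theorem level_eq (h : Round G f T t A X C B Q D A' X' C') :
    ∀ x ∈ cutL f X Q ++ cutR f X Q, G.level x = t := by
  have hX : ∀ x ∈ X, G.level x = t := fun x hx => by
    obtain ⟨n, hn, hn', hx⟩ := hasRank_of_shrink h.shrink x (by simp [hx])
    rw [hx.level_eq]
    omega
  have hQ : ∀ x ∈ Q, G.level x = t := fun x hx => by
    rw [(h.hasRank x (by simp [hx])).level_eq]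
    omega
  intro x hx
  have hspec := (innerRuns_spec h.three_le).1
  simp only [cutL, cutR, List.mem_append] at hx
  rcases hx with (hx | hx) | (hx | hx)
  · exact hX x (by rw [hspec]; simp [hx])
  · exact hQ x (List.mem_of_mem_take hx)
  · exact hQ x (List.mem_of_mem_drop hx)
  · exact hX x (by rw [hspec]; simp [hx])

theorem countIn_cutL_le (h : Round G f T t A X C B Q D A' X' C') :
    countIn (G.runStarts G.start t) (G.valPlus A).length (G.valPlus (A ++ cutL f X Q)).length ≤
      deltaL M + 4 := by
  have hhat := countIn_runStarts_hatL_le_one h.sigRuns h.nodes h.hasRank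
  have hnodes := h.nodes
  rw [← h.append_trim_append, nodesAt_append, nodesAt_append, nodesAt_append, nodesAt_append,
    zero_add] at hnodes
  have htake := countIn_runStarts_le_length hnodes.1.2.1.1
    fun x hx => h.hasRank x (by simp [List.mem_of_mem_take hx])
  have hadd := countIn_le_add (G.runStarts G.start t) (G.valPlus A).length
    (G.valPlus (A ++ hatL X)).length (G.valPlus (A ++ cutL f X Q)).length
  rw [h.valPlus_left, ← List.length_append, ← valPlus_append, List.append_assoc] at htake
  have := List.length_take_le (lenL f Q) Q
  have := h.lenL_le
  rw [cutL] at *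
  omega

theorem countIn_cutR_le (h : Round G f T t A X C B Q D A' X' C') :
    countIn (G.runStarts G.start t) (G.valPlus (A ++ (cutL f X Q ++ X'))).length
      (G.valPlus (A ++ X)).length ≤ 9 := by
  obtain ⟨hX, -, -, -⟩ := innerRuns_spec h.three_le
  have hhat := countIn_runStarts_hatR_le_one h.sigRuns h.nodes h.hasRank hX
  have hnodes := h.nodes
  rw [← h.append_trim_append, nodesAt_append, nodesAt_append, nodesAt_append, zero_add] at hnodes
  have hdrop := countIn_runStarts_le_length hnodes.1.2.2
    fun x hx => h.hasRank x (by simp [List.mem_of_mem_drop hx])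
  have hadd := countIn_le_add (G.runStarts G.start t) (G.valPlus (A ++ (cutL f X Q ++ X'))).length
    (G.valPlus (A ++ (hatL X ++ innerRuns X))).length (G.valPlus (A ++ X)).length
  have hbegin : (G.valPlus (A ++ (cutL f X Q ++ X'))).length = (G.valPlus B).length +
      (G.valPlus (Q.take (lenL f Q) ++ trim (lenL f Q) (lenR f Q) Q)).length := by
    simp only [cutL, h.valPlus_left, valPlus_append, h.valPlus_mid', List.length_append]
    omega
  have hend : (G.valPlus (A ++ (hatL X ++ innerRuns X))).length = (G.valPlus B).length +
      (G.valPlus (Q.take (lenL f Q) ++ trim (lenL f Q) (lenR f Q) Q)).length +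
      (G.valPlus (Q.drop (Q.length - lenR f Q))).length := by
    rw [add_assoc, ← List.length_append, ← valPlus_append, h.append_trim_append, h.valPlus_mid,
      h.valPlus_left]
    simp only [valPlus_append, List.length_append]
    omega
  rw [← hend, ← hbegin] at hdrop
  have : (Q.drop (Q.length - lenR f Q)).length ≤ lenR f Q := by simp; omega
  have := h.lenR_le
  omega

end Round

/-- The first `t` rounds of the construction of the common sequence of `P` are defined; they split
off `l` on the left and `r` on the right and leave `X = XShrink_t`. -/
structure IsPartialUniq (G : RLSLP α) (f : (Fin (logStar M + 11) → ℕ) → Bool) (P : List α) (t : ℕ)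
    (l X r : List ℕ) : Prop where
  left : ((List.range t).mapM (G.leftPart f P)).map List.flatten = some l
  mid : G.xshrink f P t = some X
  right : ((List.range t).reverse.mapM (G.rightPart f P)).map List.flatten = some r

theorem IsPartialUniq.zero {X : List ℕ} (hX : G.sigChars P = some X) :
    IsPartialUniq G f P 0 [] X [] :=
  ⟨rfl, hX, rfl⟩

theorem IsPartialUniq.succ {t : ℕ} {l X r Q X' : List ℕ} (h : IsPartialUniq G f P t l X r)
    (hQ : G.xpowStep X = some Q) (hX' : G.xshrinkStep f Q = some X') :
    IsPartialUniq G f P (t + 1) (l ++ cutL f X Q) X' (cutR f X Q ++ r) := by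
  obtain ⟨ls, hls, rfl⟩ := Option.map_eq_some_iff.1 h.left
  obtain ⟨rs, hrs, rfl⟩ := Option.map_eq_some_iff.1 h.right
  have hleft : G.leftPart f P t = some (cutL f X Q) := by simp [leftPart, h.mid, hQ, cutL]
  have hright : G.rightPart f P t = some (cutR f X Q) := by simp [rightPart, h.mid, hQ, cutR]
  refine ⟨?_, by simp only [xshrink, h.mid, hQ, hX', Option.bind_some], ?_⟩
  · have : (List.range (t + 1)).mapM (G.leftPart f P) = some (ls ++ [cutL f X Q]) := by
      rw [List.range_succ, mapM_append_eq_some_iff]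
      exact ⟨ls, _, hls, by simp [hleft], rfl⟩
    simp [this]
  · have : (List.range (t + 1)).reverse.mapM (G.rightPart f P) = some ([cutR f X Q] ++ rs) := by
      rw [List.range_succ, List.reverse_append, mapM_append_eq_some_iff]
      exact ⟨_, rs, by simp [hright], hrs, rfl⟩
    simp [this]

theorem IsPartialUniq.uniq_eq {l X r : List ℕ} (h : IsPartialUniq G f P (G.hP f P) l X r) :
    G.uniq f P = some (l ++ X ++ r) := by
  obtain ⟨ls, hls, rfl⟩ := Option.map_eq_some_iff.1 h.left
  obtain ⟨rs, hrs, rfl⟩ := Option.map_eq_some_iff.1 h.right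
  simp only [uniq, hls, h.mid, hrs, Option.bind_some]

/-- In the string of `G`, at most `κ` runs of level `s` begin in the interior of the prefix derived
by `l`, and at most `κ` in the suffix derived by `r`, of the factor of length `n` at position
`i`. -/
def FewRuns (G : RLSLP α) (i n κ s : ℕ) (l r : List ℕ) : Prop :=
  countIn (G.runStarts G.start s) (i + 1) (i + (G.valPlus l).length) ≤ κ ∧
    countIn (G.runStarts G.start s) (i + n - (G.valPlus r).length) (i + n) ≤ κ

theorem FewRuns.mono {i n κ κ' s : ℕ} {l r : List ℕ} (h : FewRuns G i n κ s l r) (hκ : κ ≤ κ') :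
    FewRuns G i n κ' s l r :=
  ⟨h.1.trans hκ, h.2.trans hκ⟩

theorem FewRuns.succ {i n κ s : ℕ} {l r : List ℕ} (h : FewRuns G i n (2 * κ) s l r) :
    FewRuns G i n κ (s + 1) l r := by
  have hl := runStarts_halving (G := G) G.start s (i + 1) (i + (G.valPlus l).length)
  have hr := runStarts_halving (G := G) G.start s (i + n - (G.valPlus r).length) (i + n)
  obtain ⟨hl', hr'⟩ := h
  exact ⟨by omega, by omega⟩

/-- The state of the construction of the common sequence of `P` after `t` rounds: `l` and `r` have
been split off on the left and on the right, and `X` remains in the middle. The occurrence of `P`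
is at position `i` of `T`. -/
structure State (G : RLSLP α) (f : (Fin (logStar M + 11) → ℕ) → Bool) (T : List α)
    (i : ℕ) (P : List α) (t : ℕ) (l X r : List ℕ) : Prop where
  isPartialUniq : IsPartialUniq G f P t l X r
  mid_ne : X ≠ []
  length_le : 2 ^ t * X.length ≤ P.length
  left_ne : t = 0 ∨ l ≠ []
  shrink : ∃ A C, G.shrink f T t = some (A ++ X ++ C) ∧
    (G.valPlus A).length = i + (G.valPlus l).length
  valPlus : G.valPlus (l ++ X ++ r) = P
  anchored : AnchoredAt G G.start i (l ++ X ++ r)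
  fewRuns : FewRuns G i P.length (deltaL M + 5) t l r
  fewRuns_split : ∀ s < t, ∃ l₁ l₂ r₁ r₂, l = l₁ ++ l₂ ∧ r = r₂ ++ r₁ ∧
    (∀ x ∈ l₂ ++ r₂, s < G.level x) ∧ FewRuns G i P.length (2 * deltaL M + 9) s l₁ r₁

theorem State.zero {H : ℕ} (hH : G.pow f T H = some [G.start]) {u v : List α} (hP : P ≠ [])
    (hT : T = u ++ P ++ v) : ∃ X, State G f T u.length P 0 [] X [] := by
  obtain ⟨S, -, hS, -⟩ := exists_layers_of_pow hH (nodesAt_start G) (Nat.zero_le H)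
  have hanchored := anchoredAt_of_shrink hH (Nat.zero_le H) hS
  have hchars : G.sigChars (u ++ P ++ v) = some S := hT ▸ hS
  obtain ⟨AX, C, hAX, -, rfl⟩ := mapM_append_eq_some_iff.1 hchars
  obtain ⟨A, X, hA, hX, rfl⟩ := mapM_append_eq_some_iff.1 hAX
  have hvalA : G.valPlus A = u := valPlus_of_sigChars hA
  have hvalX : G.valPlus X = P := valPlus_of_sigChars hX
  have hlen := length_eq_of_mapM_eq_some hX
  rw [anchoredAt_append, anchoredAt_append, hvalA, zero_add] at hanchored
  exact ⟨X,
    { isPartialUniq := .zero hX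
      mid_ne := by rintro rfl; exact hP (List.length_eq_zero_iff.1 hlen)
      length_le := by rw [hlen, pow_zero, one_mul]
      left_ne := Or.inl rfl
      shrink := ⟨A, C, hS, by simp [hvalA]⟩
      valPlus := by simp [hvalX]
      anchored := by simpa using hanchored.1.2
      fewRuns := by simp [FewRuns, countIn_of_le]
      fewRuns_split := by simp }⟩

theorem State.fewRuns_cut {i t : ℕ} {l X r A C B Q D A' X' C' : List ℕ}
    (h : State G f T i P t l X r) (hR : Round G f T t A X C B Q D A' X' C')
    (hA : (G.valPlus A).length = i + (G.valPlus l).length) :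
    FewRuns G i P.length (2 * deltaL M + 9) t (l ++ cutL f X Q) (cutR f X Q ++ r) := by
  have hP := congrArg List.length h.valPlus
  have hX := congrArg List.length hR.valPlus_eq
  have hL := hR.countIn_cutL_le
  have hR := hR.countIn_cutR_le
  obtain ⟨hl, hr⟩ := h.fewRuns
  simp only [valPlus_append, List.length_append, hA] at hP hX hL hR
  have hbegin : i + P.length - (G.valPlus (cutR f X Q ++ r)).length =
      i + (G.valPlus l).length + ((G.valPlus (cutL f X Q)).length + (G.valPlus X').length) := by
    simp only [valPlus_append, List.length_append]
    omega
  have hmid : i + P.length - (G.valPlus r).length =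
      i + (G.valPlus l).length + (G.valPlus X).length := by
    omega
  have hend : i + (G.valPlus (l ++ cutL f X Q)).length =
      i + (G.valPlus l).length + (G.valPlus (cutL f X Q)).length := by
    rw [valPlus_append, List.length_append, add_assoc]
  rw [hmid] at hr
  constructor
  · rw [hend]
    refine (countIn_le_add _ _ (i + (G.valPlus l).length) _).trans ?_
    omega
  · rw [hbegin]
    refine (countIn_le_add _ _ (i + (G.valPlus l).length + (G.valPlus X).length) _).trans ?_
    have : 6 ≤ deltaL M := Nat.le_add_left 6 _
    omega

theorem State.succ (hf : IsLocallyConsistent M f) (hM : ∀ x ∈ G.vars, x ≤ M) {H i t : ℕ}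
    (hH : G.pow f T H = some [G.start]) {l X r : List ℕ} (h : State G f T i P t l X r)
    (ht : t ≤ H) (hX : deltaL M + 14 ≤ (epow X).length) :
    t < H ∧ ∃ l' X' r', State G f T i P (t + 1) l' X' r' := by
  obtain ⟨A, C, hs, hA⟩ := h.shrink
  obtain ⟨hlt, B, Q, D, A', X', C', hR⟩ := exists_round hf hM hH ht hs hX
  have hfew := h.fewRuns_cut hR hA
  have hanchored : AnchoredAt G G.start i (l ++ (cutL f X Q ++ X' ++ cutR f X Q) ++ r) := by
    have := hR.anchoredAt
    rw [hA] at this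
    exact h.anchored.replace this hR.valPlus_eq
  have hval : G.valPlus (l ++ (cutL f X Q ++ X' ++ cutR f X Q) ++ r) = P := by
    rw [← h.valPlus, valPlus_append, valPlus_append, hR.valPlus_eq]
    simp only [valPlus_append]
  refine ⟨hlt, l ++ cutL f X Q, X', cutR f X Q ++ r,
    { isPartialUniq := h.isPartialUniq.succ hR.xpowStep hR.xshrinkStep
      mid_ne := hR.ne_nil
      length_le := ?_
      left_ne := Or.inr ?_
      shrink := ⟨A', C', hR.shrink_succ, ?_⟩
      valPlus := by simpa only [List.append_assoc] using hval
      anchored := by simpa only [List.append_assoc] using hanchored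
      fewRuns := (hfew.mono (by omega)).succ
      fewRuns_split := fun s hst => ?_ }⟩
  · calc 2 ^ (t + 1) * X'.length = 2 ^ t * (2 * X'.length) := by ring
      _ ≤ 2 ^ t * X.length := Nat.mul_le_mul_left _ hR.two_mul_length_le
      _ ≤ P.length := h.length_le
  · simp [cutL, hatL_ne_nil h.mid_ne]
  · simp only [hR.valPlus_append_cutL, valPlus_append, List.length_append, hA, add_assoc]
  · rcases Nat.lt_succ_iff_lt_or_eq.1 hst with hst | rfl
    · obtain ⟨l₁, l₂, r₁, r₂, rfl, rfl, hlevel, hfew⟩ := h.fewRuns_split s hst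
      refine ⟨l₁, l₂ ++ cutL f X Q, r₁, cutR f X Q ++ r₂, by simp, by simp, fun x hx => ?_, hfew⟩
      have : x ∈ l₂ ++ r₂ ∨ x ∈ cutL f X Q ++ cutR f X Q := by
        simp only [List.mem_append] at hx ⊢
        tauto
      exact this.elim (hlevel x) fun hx => (hR.level_eq x hx).symm ▸ hst
    · exact ⟨_, [], _, [], by simp, by simp, by simp, hfew⟩

theorem exists_state (hf : IsLocallyConsistent M f) (hM : ∀ x ∈ G.vars, x ≤ M) {H : ℕ}
    (hH : G.pow f T H = some [G.start]) {u v : List α} (hP : P ≠ []) (hT : T = u ++ P ++ v) (t : ℕ)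
    (ht : ∀ s < t, ∀ X, G.xshrink f P s = some X → deltaL M + 14 ≤ (epow X).length) :
    t ≤ H ∧ ∃ l X r, State G f T u.length P t l X r := by
  induction t with
  | zero =>
    obtain ⟨X, hX⟩ := State.zero hH hP hT
    exact ⟨Nat.zero_le H, [], X, [], hX⟩
  | succ t ih =>
    obtain ⟨htH, l, X, r, h⟩ := ih fun s hs => ht s (by omega)
    exact h.succ hf hM hH htH (ht t (by omega) X h.isPartialUniq.mid)

theorem exists_state_hP (hf : IsLocallyConsistent M f) (hM : ∀ x ∈ G.vars, x ≤ M) {H : ℕ}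
    (hH : G.pow f T H = some [G.start]) {u v : List α} (hP : P ≠ []) (hT : T = u ++ P ++ v) :
    G.hP f P ≤ H ∧ ∃ l X r, State G f T u.length P (G.hP f P) l X r ∧
      (epow X).length ≤ deltaL M + 13 := by
  set S : Set ℕ := {t | ∃ s, G.xshrink f P t = some s ∧ (epow s).length ≤ deltaL M + deltaR + 9}
  have hlong : ∀ t ∉ S, ∀ X, G.xshrink f P t = some X → deltaL M + 14 ≤ (epow X).length := by
    intro t ht X hX
    by_contra hlt
    exact ht ⟨X, hX, by simp only [deltaR]; omega⟩
  have hne : S.Nonempty := by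
    rw [Set.nonempty_iff_ne_empty]
    intro hempty
    have := (exists_state hf hM hH hP hT (H + 1) fun s _ => hlong s (by simp [hempty])).1
    omega
  obtain ⟨hle, l, X, r, h⟩ := exists_state hf hM hH hP hT (sInf S)
    fun s hs => hlong s (Nat.notMem_of_lt_sInf hs)
  obtain ⟨X', hX', hlen⟩ := Nat.sInf_mem hne
  obtain rfl := Option.some.inj (h.isPartialUniq.mid.symm.trans hX')
  exact ⟨hle, l, X, r, h, hlen⟩

end RLSLP

end SigEnc

namespace SigEnc

/-! ### Sums and logarithms -/

theorem finite_and_ncard_biUnion_le {ι β : Type*} {t : Finset ι} {N : ι → Set β} {b : ι → ℕ}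
    (h : ∀ i ∈ t, (N i).Finite ∧ (N i).ncard ≤ b i) :
    (⋃ i ∈ t, N i).Finite ∧ (⋃ i ∈ t, N i).ncard ≤ ∑ i ∈ t, b i :=
  ⟨t.finite_toSet.biUnion fun i hi => (h i hi).1,
    (t.set_ncard_biUnion_le N).trans (Finset.sum_le_sum fun i hi => (h i hi).2)⟩

theorem sum_range_mul_comp_div (g : ℕ → ℕ) {m : ℕ} (hm : 0 < m) (k : ℕ) :
    ∑ n ∈ Finset.range (m * k), g (n / m) = m * ∑ s ∈ Finset.range k, g s := by
  induction k with
  | zero => simp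
  | succ k ih =>
    have hdiv : ∀ j ∈ Finset.range m, g ((m * k + j) / m) = g k := fun j hj => by
      rw [Nat.mul_add_div hm, Nat.div_eq_of_lt (Finset.mem_range.1 hj), add_zero]
    rw [Nat.mul_succ, Finset.sum_range_add, ih, Finset.sum_range_succ, Finset.sum_congr rfl hdiv,
      Finset.sum_const, Finset.card_range, smul_eq_mul, mul_add]

theorem sum_halving_le {d : ℕ → ℕ} (h : ∀ k, 2 * d (k + 1) ≤ d k + 1) (n : ℕ) :
    ∑ k ∈ Finset.range n, d k + 2 * d n ≤ 2 * d 0 + n := by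
  induction n with
  | zero => simp
  | succ n ih =>
    have := h n
    rw [Finset.sum_range_succ]
    omega

theorem le_add_one_of_halving {d : ℕ → ℕ} (h : ∀ k, 2 * d (k + 1) ≤ d k + 1) (n : ℕ) :
    d n ≤ d 0 + 1 := by
  induction n with
  | zero => omega
  | succ n ih =>
    have := h n
    omega

theorem natCast_le_logb_of_two_pow_le {k m : ℕ} (h : 2 ^ k ≤ m) : (k : ℝ) ≤ Real.logb 2 m := by
  have hm : 0 < m := lt_of_lt_of_le (by positivity) h
  rw [Real.le_logb_iff_rpow_le one_lt_two (by exact_mod_cast hm), Real.rpow_natCast]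
  exact_mod_cast h

theorem le_logb_mul_of_le {D K n : ℕ} (hn : 0 < n) (hD : D ≤ K) (hD₁ : n = 1 → D = 0) :
    (D : ℝ) ≤ Real.logb 2 n * K := by
  rcases Nat.lt_or_ge n 2 with h | h
  · simp [hD₁ (by omega), show n = 1 by omega]
  · have hlog : (1 : ℝ) ≤ Real.logb 2 n := by
      simpa using natCast_le_logb_of_two_pow_le (k := 1) (by simpa using h)
    calc (D : ℝ) ≤ K := by exact_mod_cast hD
      _ ≤ Real.logb 2 n * K := le_mul_of_one_le_left (by positivity) hlog

namespace RLSLP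

variable {α : Type*} {G : RLSLP α}

/-! ### Nodes of the induced subtree -/

theorem le_or_le_of_getElem?_append {l m r : List ℕ} {j x : ℕ} (h : (l ++ m ++ r)[j]? = some x)
    (hx : x ∉ m) :
    (G.valPlus ((l ++ m ++ r).take j)).length + (G.val x).length ≤ (G.valPlus l).length ∨
      (G.valPlus (l ++ m)).length ≤ (G.valPlus ((l ++ m ++ r).take j)).length := by
  rcases lt_or_ge j l.length with hl | hl
  · left
    simpa [List.append_assoc] using length_valPlus_take_add_le_of_lt (G := G) h hl
  · right
    have hm : (l ++ m).length ≤ j := by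
      by_contra! hlt
      rw [List.getElem?_append_left hlt, List.getElem?_append_right hl] at h
      exact hx (List.mem_of_getElem? h)
    exact length_valPlus_le_of_prefix (List.prefix_take_iff.2 ⟨List.prefix_append _ _, hm⟩)

/-- The sequence `U`, read in the string of `G` from position `i` on, consists of a prefix and a
suffix in whose interior at most `κ` runs of level `s` begin, and of entries of level greater than
`s` between them. -/
def FewRunsOutside (G : RLSLP α) (i κ s : ℕ) (U : List ℕ) : Prop :=
  ∃ l m r, U = l ++ m ++ r ∧ (∀ x ∈ m, s < G.level x) ∧
    FewRuns G i (G.valPlus U).length κ s l r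

/-- The nodes of rank `n` in the subtree induced by `U`. -/
def rankNodes (G : RLSLP α) (e i : ℕ) (U : List ℕ) (n : ℕ) : Set (List ℕ) :=
  {π | π ∈ G.inducedSubtree e i U ∧ ∃ z, G.label e π = some z ∧ HasRank G n z}

section

variable {n₀ n s κ e i : ℕ} {ρ U : List ℕ}

theorem exists_entry_of_mem_rankNodes (hstart : HasRank G n₀ G.start)
    (hρ : G.label G.start ρ = some e) (hU : AnchoredAt G G.start (G.offset G.start ρ + i) U)
    {π : List ℕ} (hπ : π ∈ rankNodes G e i U n) :
    ∃ z, G.label G.start (ρ ++ π) = some z ∧ HasRank G n z ∧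
      ∃ j x, U[j]? = some x ∧ 0 < (G.val x).length ∧ 4 * G.level x < n ∧
        G.offset G.start (ρ ++ π) ≤ G.offset G.start ρ + i + (G.valPlus (U.take j)).length ∧
        G.offset G.start ρ + i + (G.valPlus (U.take j)).length + (G.val x).length ≤
          G.offset G.start (ρ ++ π) + (G.val z).length := by
  obtain ⟨⟨j, μ, c, ⟨x, hj, hx, hoffset⟩, τ, rfl⟩, z, hz, hzn⟩ := hπ
  obtain ⟨σ, hσ, hσoffset, hanchored⟩ := hU.exists_label hj
  obtain ⟨m, hxm, -⟩ := hstart.exists_of_label hσ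
  have hz' : G.label G.start (ρ ++ π) = some z := by rw [label_append hρ, hz]
  have hx' : G.label G.start (ρ ++ (π ++ τ ++ [c])) = some x := by rw [label_append hρ, hx]
  have hoffset' : G.offset G.start (ρ ++ (π ++ τ ++ [c])) =
      G.offset G.start ρ + i + (G.valPlus (U.take j)).length := by
    rw [offset_append hρ, hoffset, add_assoc]
  have hpos := hxm.length_val_pos
  obtain rfl := hxm.eq_of_overlap hxm hσ hx' (by omega) (by omega)
  have hsplit : ρ ++ (π ++ τ ++ [c]) = (ρ ++ π) ++ (τ ++ [c]) := by simp
  rw [hsplit] at hx' hoffset' hanchored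
  rw [label_append hz'] at hx'
  rw [offset_append hz'] at hoffset'
  have := offset_add_le hx'
  exact ⟨z, hz', hzn, j, x, hj, hpos,
    hanchored _ z n (List.prefix_append _ _) (by simp) hz' hzn, by omega, by omega⟩

theorem ncard_rankNodes_le (hstart : HasRank G n₀ G.start) (hρ : G.label G.start ρ = some e)
    (hU : AnchoredAt G G.start (G.offset G.start ρ + i) U)
    (hfew : FewRunsOutside G (G.offset G.start ρ + i) κ (n / 4) U) :
    (rankNodes G e i U (n + 1)).Finite ∧ (rankNodes G e i U (n + 1)).ncard ≤ 2 * (κ + 1) := by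
  obtain ⟨l, m, r, rfl, hm, hl, hr⟩ := hfew
  set o := G.offset G.start ρ + i
  let V (x y : ℕ) : Set (List ℕ) := {σ | ∃ z, G.label G.start σ = some z ∧
    HasRank G (n + 1) z ∧ x < G.offset G.start σ + (G.val z).length ∧ G.offset G.start σ < y}
  have hV (x y : ℕ) (h : countIn (G.runStarts G.start (n / 4)) (x + 1) y ≤ κ) :
      (V x y).Finite ∧ (V x y).ncard ≤ κ + 1 :=
    (ncard_nodes_le (t := n / 4) (by omega) (by omega) fun _ h => h).imp_right
      fun h' => h'.trans (Nat.succ_le_succ h)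
  obtain ⟨hAfin, hA⟩ := hV o (o + (G.valPlus l).length) hl
  obtain ⟨hBfin, hB⟩ := hV (o + (G.valPlus (l ++ m)).length)
    (o + (G.valPlus (l ++ m ++ r)).length) <| (countIn_mono _ (by
      simp only [valPlus_append, List.length_append]
      omega) le_rfl).trans hr
  have hmem : ∀ π ∈ rankNodes G e i (l ++ m ++ r) (n + 1),
      ρ ++ π ∈ V o (o + (G.valPlus l).length) ∪ V (o + (G.valPlus (l ++ m)).length)
        (o + (G.valPlus (l ++ m ++ r)).length) := fun π hπ => by
    obtain ⟨z, hz, hzn, j, x, hj, hpos, hlevel, hle, hle'⟩ :=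
      exists_entry_of_mem_rankNodes hstart hρ hU hπ
    have hjU := length_valPlus_take_add_le (G := G) hj
    have hxm : x ∉ m := fun hx => by
      have := hm x hx
      omega
    exact (le_or_le_of_getElem?_append (G := G) hj hxm).imp
      (fun _ => ⟨z, hz, hzn, by omega, by omega⟩) fun _ => ⟨z, hz, hzn, by omega, by omega⟩
  have hsub := Set.image_subset_iff.2 hmem
  have hfin := hAfin.union hBfin
  have hinj : Function.Injective (ρ ++ · : List ℕ → List ℕ) := List.append_right_injective ρ
  refine ⟨(hfin.subset hsub).of_finite_image hinj.injOn, ?_⟩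
  rw [← Set.ncard_image_of_injective _ hinj]
  exact ((Set.ncard_le_ncard hsub hfin).trans (Set.ncard_union_le _ _)).trans (by omega)

theorem exists_mem_rankNodes (hstart : HasRank G n₀ G.start) (hρ : G.label G.start ρ = some e)
    (hU : AnchoredAt G G.start (G.offset G.start ρ + i) U) (he : HasRank G n e)
    {π : List ℕ} (hπ : π ∈ G.inducedSubtree e i U) : ∃ m < n, π ∈ rankNodes G e i U (m + 1) := by
  obtain ⟨j, μ, c, ⟨x, -, hx, -⟩, τ, rfl⟩ := id hπ
  rw [List.append_assoc] at hx
  obtain ⟨z, hz, -⟩ := exists_label_of_append hx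
  obtain ⟨k, hzk, hkn⟩ := he.exists_of_label hz
  obtain ⟨-, -, -, j, x, -, -, hlevel, -⟩ :=
    exists_entry_of_mem_rankNodes hstart hρ hU ⟨hπ, z, hz, hzk⟩
  have hle : k ≤ n := by
    rcases eq_or_ne π [] with rfl | hne
    · cases hz
      exact (hzk.unique he).le
    · exact (hkn hne).le
  refine ⟨k - 1, by omega, hπ, z, hz, ?_⟩
  rwa [Nat.sub_add_cancel (by omega)]

theorem finite_and_ncard_inducedSubtree_le {b : ℕ → ℕ} (hstart : HasRank G n₀ G.start)
    (hρ : G.label G.start ρ = some e) (hU : AnchoredAt G G.start (G.offset G.start ρ + i) U)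
    (hfew : ∀ s, FewRunsOutside G (G.offset G.start ρ + i) (b s) s U) :
    (G.inducedSubtree e i U).Finite ∧ (G.inducedSubtree e i U).ncard ≤
      8 * (∑ s ∈ Finset.range (G.level e + 1), b s + (G.level e + 1)) := by
  obtain ⟨n, he, -⟩ := hstart.exists_of_label hρ
  have hsub : G.inducedSubtree e i U ⊆
      ⋃ m ∈ Finset.range (4 * (G.level e + 1)), rankNodes G e i U (m + 1) := fun π hπ => by
    obtain ⟨m, hm, hπm⟩ := exists_mem_rankNodes hstart hρ hU he hπ
    have := he.level_eq
    exact Set.mem_biUnion (Finset.mem_coe.2 (Finset.mem_range.2 (by omega))) hπm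
  obtain ⟨hfin, hcard⟩ := finite_and_ncard_biUnion_le
    (t := Finset.range (4 * (G.level e + 1))) (b := fun m => 2 * (b (m / 4) + 1))
    fun m _ => ncard_rankNodes_le hstart hρ hU (hfew (m / 4))
  refine ⟨hfin.subset hsub, (Set.ncard_le_ncard hsub hfin).trans (hcard.trans ?_)⟩
  rw [sum_range_mul_comp_div (fun s => 2 * (b s + 1)) four_pos, ← Finset.mul_sum,
    Finset.sum_add_distrib, Finset.sum_const, Finset.card_range, smul_eq_mul]
  omega

theorem ncard_inducedSubtree_inter_levelNodes_le {b : ℕ} (hstart : HasRank G n₀ G.start)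
    (hρ : G.label G.start ρ = some e) (hU : AnchoredAt G G.start (G.offset G.start ρ + i) U)
    (hfew : ∀ s, FewRunsOutside G (G.offset G.start ρ + i) b s U) (t : ℕ) :
    (G.inducedSubtree e i U ∩ G.levelNodes e t).ncard ≤ 8 * (b + 1) := by
  obtain ⟨n, he, -⟩ := hstart.exists_of_label hρ
  have hsub : G.inducedSubtree e i U ∩ G.levelNodes e t ⊆
      ⋃ m ∈ Finset.Ico (4 * t - 3) (4 * t + 1), rankNodes G e i U (m + 1) := by
    rintro π ⟨hπ, x, hx, hxt⟩
    obtain ⟨m, -, hπm⟩ := exists_mem_rankNodes hstart hρ hU he hπ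
    obtain ⟨-, z, hz, hzm⟩ := id hπm
    obtain rfl := Option.some.inj (hx.symm.trans hz)
    have := hzm.level_eq
    exact Set.mem_biUnion (Finset.mem_coe.2 (Finset.mem_Ico.2 (by omega))) hπm
  obtain ⟨hfin, hcard⟩ := finite_and_ncard_biUnion_le
    (t := Finset.Ico (4 * t - 3) (4 * t + 1)) (b := fun _ => 2 * (b + 1))
    fun m _ => ncard_rankNodes_le hstart hρ hU (hfew (m / 4))
  refine (Set.ncard_le_ncard hsub hfin).trans (hcard.trans ?_)
  rw [Finset.sum_const, Nat.card_Ico, smul_eq_mul]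
  calc (4 * t + 1 - (4 * t - 3)) * (2 * (b + 1)) ≤ 4 * (2 * (b + 1)) :=
        Nat.mul_le_mul_right _ (by omega)
    _ = 8 * (b + 1) := by ring

end

end RLSLP

end SigEnc

namespace SigEnc.RLSLP

variable {α : Type*} {G : RLSLP α}

/-! ### Bounds for the number of runs -/

/-- The bound for the number of runs of level `s` that begin inside the parts of an occurrence of
length `n` at position `i` that are represented by entries of level at most `s`: the constant `κ` in
the rounds before `t`, and the number of all runs inside the occurrence from round `t` on. -/
noncomputable def runBound (G : RLSLP α) (κ t i n s : ℕ) : ℕ :=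
  if s < t then κ else countIn (G.runStarts G.start s) (i + 1) (i + n)

theorem runBound_of_lt {κ t i n s : ℕ} (h : s < t) : runBound G κ t i n s = κ := if_pos h

theorem runBound_add (κ t i n s : ℕ) :
    runBound G κ t i n (t + s) = countIn (G.runStarts G.start (t + s)) (i + 1) (i + n) :=
  if_neg (Nat.not_lt.2 (Nat.le_add_right t s))

theorem sum_runBound_le (κ t i n k : ℕ) :
    ∑ s ∈ Finset.range k, runBound G κ t i n s ≤
      t * κ + 2 * countIn (G.runStarts G.start t) (i + 1) (i + n) + k := by
  have hinit : ∑ s ∈ Finset.range t, runBound G κ t i n s = t * κ := by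
    rw [Finset.sum_congr rfl fun s hs => runBound_of_lt (Finset.mem_range.1 hs)]
    simp
  have hhalving := sum_halving_le
    (d := fun s => countIn (G.runStarts G.start (t + s)) (i + 1) (i + n))
    (fun s => runStarts_halving _ _ _ _) k
  calc ∑ s ∈ Finset.range k, runBound G κ t i n s
      ≤ ∑ s ∈ Finset.range (t + k), runBound G κ t i n s :=
        Finset.sum_le_sum_of_subset (Finset.range_mono (Nat.le_add_left k t))
    _ = t * κ + ∑ s ∈ Finset.range k, countIn (G.runStarts G.start (t + s)) (i + 1) (i + n) := by
        simp only [Finset.sum_range_add, hinit, runBound_add]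
    _ ≤ _ := by
        rw [add_zero] at hhalving
        omega

theorem runBound_le {κ t i n D : ℕ} (hκ : κ ≤ D)
    (hD : countIn (G.runStarts G.start t) (i + 1) (i + n) ≤ D) (s : ℕ) :
    runBound G κ t i n s ≤ D + 1 := by
  rcases lt_or_ge s t with hs | hs
  · rw [runBound_of_lt hs]
    omega
  · obtain ⟨k, rfl⟩ := Nat.exists_eq_add_of_le hs
    rw [runBound_add]
    exact (le_add_one_of_halving
      (d := fun s => countIn (G.runStarts G.start (t + s)) (i + 1) (i + n))
      (fun s => runStarts_halving _ _ _ _) k).trans (Nat.succ_le_succ hD)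

theorem FewRunsOutside.mono {i κ κ' s : ℕ} {U : List ℕ} (h : FewRunsOutside G i κ s U)
    (hκ : κ ≤ κ') : FewRunsOutside G i κ' s U := by
  obtain ⟨l, m, r, hU, hm, hfew⟩ := h
  exact ⟨l, m, r, hU, hm, hfew.mono hκ⟩

theorem length_val_add_length_le {Y : List ℕ} (h : ∀ y ∈ Y, 0 < (G.val y).length) {x : ℕ}
    (hx : x ∈ Y) : (G.val x).length + Y.length ≤ (G.valPlus Y).length + 1 := by
  have hle : ∀ Z : List ℕ, (∀ y ∈ Z, 0 < (G.val y).length) →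
      Z.length ≤ (G.valPlus Z).length := fun Z hZ => by
    simpa [RLSLP.valPlus] using
      List.length_le_sum_of_one_le (Z.map (List.length ∘ G.val)) (List.forall_mem_map.2 hZ)
  obtain ⟨A, C, rfl⟩ := List.append_of_mem hx
  have hA := hle A fun y hy => h y (by simp [hy])
  have hC := hle C fun y hy => h y (by simp [hy])
  simp only [valPlus_append, valPlus_cons, List.length_append, List.length_cons]
  omega

theorem HasRank.two_le {n M x : ℕ} (h : HasRank G n x) (hn : 0 < n) (hM : ∀ x ∈ G.vars, x ≤ M) :
    2 ≤ M := by
  obtain ⟨y, hy⟩ := List.exists_mem_of_ne_nil _ (h.children_ne_nil hn)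
  obtain ⟨m, hm, hmy⟩ := h.exists_of_mem_children hy
  have hne : x ≠ y := by
    rintro rfl
    exact hm.ne (hmy.unique h)
  have := hM x h.mem_vars
  have := hM y hmy.mem_vars
  have := G.var_pos x h.mem_vars
  have := G.var_pos y hmy.mem_vars
  omega

theorem HasRank.pos_of_two_le_length_val {n x : ℕ} (h : HasRank G n x)
    (hx : 2 ≤ (G.val x).length) : 0 < n := by
  cases h with
  | char h => simp [val_of_char h] at hx
  | run => omega
  | pair => omega

variable {M : ℕ} {f : (Fin (logStar M + 11) → ℕ) → Bool} {T P : List α}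

/-! ### The common sequence in a derivation tree -/

theorem exists_state_of_val_eq (hf : IsLocallyConsistent M f) (hM : ∀ x ∈ G.vars, x ≤ M) {H : ℕ}
    (hH : G.pow f T H = some [G.start]) {e : ℕ} (he : e ∈ G.vars) {u v : List α} (hP : P ≠ [])
    (hval : G.val e = u ++ P ++ v) :
    ∃ ρ l X r, G.label G.start ρ = some e ∧ G.hP f P ≤ H ∧
      (epow X).length ≤ deltaL M + 13 ∧
      State G f T (G.offset G.start ρ + u.length) P (G.hP f P) l X r := by
  obtain ⟨ρ, hρ⟩ := exists_label_of_mem_vars he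
  obtain ⟨u', v', hstart, hu'⟩ := val_eq_append_of_label hρ
  have hT : T = (u' ++ u) ++ P ++ (v ++ v') := by
    rw [← valPlus_of_pow hH, valPlus_cons, valPlus_nil, List.append_nil, hstart, hval]
    simp only [List.append_assoc]
  obtain ⟨hle, l, X, r, hs, hX⟩ := exists_state_hP hf hM hH hP hT
  rw [List.length_append, hu'] at hs
  exact ⟨ρ, l, X, r, hρ, hle, hX, hs⟩

namespace State

variable {n₀ H e i t : ℕ} {l X r ρ : List ℕ}

theorem fewRunsOutside (h : State G f T i P t l X r) (s : ℕ) :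
    FewRunsOutside G i (runBound G (2 * deltaL M + 9) t i P.length s) s (l ++ X ++ r) := by
  unfold FewRunsOutside
  rw [h.valPlus]
  rcases lt_or_ge s t with hs | hs
  · obtain ⟨l₁, l₂, r₁, r₂, hl, hr, hlevel, hfew⟩ := h.fewRuns_split s hs
    refine ⟨l₁, l₂ ++ X ++ r₂, r₁, by simp [hl, hr], fun x hx => ?_, runBound_of_lt hs ▸ hfew⟩
    have hx : x ∈ l₂ ++ r₂ ∨ x ∈ X := by
      simp only [List.mem_append] at hx ⊢
      tauto
    rcases hx with hx | hx
    · exact hlevel x hx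
    · obtain ⟨A, C, hshrink, -⟩ := h.shrink
      obtain ⟨n, hn, -, hxn⟩ := hasRank_of_shrink hshrink x (by simp [hx])
      rw [hxn.level_eq]
      omega
  · obtain ⟨k, rfl⟩ := Nat.exists_eq_add_of_le hs
    rw [runBound_add]
    exact ⟨l ++ X ++ r, [], [], by simp, by simp, by rw [h.valPlus], by simp [countIn_of_le]⟩

theorem countIn_runStarts_le (h : State G f T i P t l X r) (hH : G.pow f T H = some [G.start])
    (ht : t ≤ H) (hX : (epow X).length ≤ deltaL M + 13) :
    countIn (G.runStarts G.start t) (i + 1) (i + P.length) ≤ 3 * deltaL M + 23 := by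
  obtain ⟨A, C, hshrink, hA⟩ := h.shrink
  obtain ⟨s, p, hs, hp, hsp, -, hnodes⟩ := exists_layers_of_pow hH (nodesAt_start G) ht
  obtain rfl := Option.some.inj (hshrink.symm.trans hs)
  have hmid := countIn_runStarts_le_length_epow hsp hnodes (hasRank_of_pow hp)
  rw [valPlus_append, List.length_append, hA] at hmid
  obtain ⟨hl, hr⟩ := h.fewRuns
  have hP := congrArg List.length h.valPlus
  simp only [valPlus_append, List.length_append] at hP
  rw [show i + P.length - (G.valPlus r).length =
    i + (G.valPlus l).length + (G.valPlus X).length by omega] at hr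
  have hsplit := countIn_le_add (G.runStarts G.start t) (i + 1) (i + (G.valPlus l).length)
    (i + P.length)
  have hsplit' := countIn_le_add (G.runStarts G.start t) (i + (G.valPlus l).length)
    (i + (G.valPlus l).length + (G.valPlus X).length) (i + P.length)
  omega

theorem exists_hasRank (h : State G f T i P t l X r) (hstart : HasRank G n₀ G.start) {x : ℕ}
    (hx : x ∈ l ++ X ++ r) : ∃ n, HasRank G n x := by
  obtain ⟨j, hj⟩ := List.mem_iff_getElem?.1 hx
  obtain ⟨σ, hσ, -⟩ := h.anchored.exists_label hj
  obtain ⟨n, hn, -⟩ := hstart.exists_of_label hσ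
  exact ⟨n, hn⟩

theorem eq_nil_of_label (h : State G f T i P t l X r) (hstart : HasRank G n₀ G.start) {x : ℕ}
    (hx : x ∈ l ++ X ++ r) {τ : List ℕ} (hτ : G.label x τ = some e)
    (he : P.length ≤ (G.val e).length) : τ = [] := by
  have hlen := length_val_add_length_le (fun y hy => by
    obtain ⟨n, hn⟩ := h.exists_hasRank hstart hy
    exact hn.length_val_pos) hx
  have hle := offset_add_le hτ
  have hX := List.length_pos_iff.2 h.mid_ne
  simp only [h.valPlus, List.length_append] at hlen
  obtain rfl : l = [] := List.length_eq_zero_iff.1 (by omega)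
  obtain rfl : r = [] := List.length_eq_zero_iff.1 (by omega)
  obtain rfl : t = 0 := h.left_ne.resolve_right (by simp)
  obtain ⟨A, C, hshrink, -⟩ := h.shrink
  obtain ⟨n, -, hn, hxn⟩ := hasRank_of_shrink hshrink x (by simp_all)
  obtain ⟨m, -, hm⟩ := hxn.exists_of_label hτ
  by_contra hne
  have := hm hne
  omega

theorem represents {u v : List α} (hρ : G.label G.start ρ = some e)
    (h : State G f T (G.offset G.start ρ + u.length) P t l X r) (hstart : HasRank G n₀ G.start)
    (he : G.val e = u ++ P ++ v) : G.Represents e u.length P (l ++ X ++ r) := by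
  refine ⟨h.valPlus, fun j hj => ?_⟩
  have hjx := List.getElem?_eq_getElem hj
  set x := (l ++ X ++ r)[j]
  have hxU : x ∈ l ++ X ++ r := List.mem_of_getElem? hjx
  obtain ⟨σ, hσ, hoffset, -⟩ := h.anchored.exists_label hjx
  obtain ⟨n, hxn⟩ := h.exists_hasRank hstart hxU
  have hpos := hxn.length_val_pos
  have hle := length_valPlus_take_add_le (G := G) hjx
  have hval := congrArg List.length he
  rw [h.valPlus] at hle
  simp only [List.length_append] at hval
  suffices ρ <+: σ by
    obtain ⟨π, rfl⟩ := this
    rw [label_append hρ] at hσ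
    rw [offset_append hρ, add_assoc] at hoffset
    exact ⟨π, x, hjx, hσ, Nat.add_left_cancel hoffset⟩
  refine (prefix_or_prefix_of_overlap hρ hσ (by omega) (by omega)).elim id ?_
  rintro ⟨τ, rfl⟩
  rw [label_append hσ] at hρ
  obtain rfl := h.eq_nil_of_label hstart hxU hρ (by omega)
  simp

theorem ncard_levelNodes_le (hρ : G.label G.start ρ = some e)
    (h : State G f T (G.offset G.start ρ + i) P t l X r) (hM : ∀ x ∈ G.vars, x ≤ M)
    (hH : G.pow f T H = some [G.start]) (ht : t ≤ H) (hX : (epow X).length ≤ deltaL M + 13)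
    (s : ℕ) :
    (G.inducedSubtree e i (l ++ X ++ r) ∩ G.levelNodes e s).ncard ≤ 1000 * logStar M := by
  have hstart : HasRank G (4 * H + 1) G.start := hasRank_of_pow hH _ (by simp)
  rcases (G.inducedSubtree e i (l ++ X ++ r) ∩ G.levelNodes e s).eq_empty_or_nonempty with
    hempty | ⟨π, hπ, -⟩
  · rw [hempty, Set.ncard_empty]
    exact Nat.zero_le _
  obtain ⟨n, he, -⟩ := hstart.exists_of_label hρ
  obtain ⟨m, -, -, z, -, hz⟩ := exists_mem_rankNodes hstart hρ h.anchored he hπ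
  have hlogStar := one_le_logStar (hz.two_le m.succ_pos hM)
  have hcount := ncard_inducedSubtree_inter_levelNodes_le hstart hρ h.anchored
    (fun s => (h.fewRunsOutside s).mono
      (runBound_le (by omega) (h.countIn_runStarts_le hH ht hX) s)) s
  simp only [deltaL] at hcount
  omega

theorem finite_inducedSubtree (hρ : G.label G.start ρ = some e)
    (h : State G f T (G.offset G.start ρ + i) P t l X r) (hstart : HasRank G n₀ G.start) :
    (G.inducedSubtree e i (l ++ X ++ r)).Finite :=
  (finite_and_ncard_inducedSubtree_le hstart hρ h.anchored h.fewRunsOutside).1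

theorem ncard_inducedSubtree_le (hρ : G.label G.start ρ = some e)
    (h : State G f T (G.offset G.start ρ + i) P t l X r) (hM : ∀ x ∈ G.vars, x ≤ M)
    (hH : G.pow f T H = some [G.start]) (ht : t ≤ H) (hX : (epow X).length ≤ deltaL M + 13)
    (he : 2 ≤ (G.val e).length) :
    ((G.inducedSubtree e i (l ++ X ++ r)).ncard : ℝ) ≤
      1000 * (Real.logb 2 (G.val e).length + Real.logb 2 P.length * logStar M) := by
  have hstart : HasRank G (4 * H + 1) G.start := hasRank_of_pow hH _ (by simp)
  obtain ⟨n, hen, -⟩ := hstart.exists_of_label hρ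
  have hlogStar := one_le_logStar (hen.two_le (hen.pos_of_two_le_length_val he) hM)
  have htP : 2 ^ t ≤ P.length :=
    (Nat.le_mul_of_pos_right _ (List.length_pos_iff.2 h.mid_ne)).trans h.length_le
  have hlevel : (G.level e : ℝ) ≤ Real.logb 2 (G.val e).length :=
    natCast_le_logb_of_two_pow_le (hen.level_eq ▸ hen.two_pow_le_length_val)
  have hone : (1 : ℝ) ≤ Real.logb 2 (G.val e).length := by
    simpa using natCast_le_logb_of_two_pow_le (k := 1) (by simpa using he)
  set D := countIn (G.runStarts G.start t) (G.offset G.start ρ + i + 1)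
    (G.offset G.start ρ + i + P.length)
  have hcount := (finite_and_ncard_inducedSubtree_le hstart hρ h.anchored h.fewRunsOutside).2
  have hsum := sum_runBound_le (G := G) (2 * deltaL M + 9) t (G.offset G.start ρ + i) P.length
    (G.level e + 1)
  have hD : (D : ℝ) ≤ Real.logb 2 P.length * (44 * logStar M : ℕ) := by
    have hD := h.countIn_runStarts_le hH ht hX
    simp only [deltaL] at hD
    exact le_logb_mul_of_le (lt_of_lt_of_le (by positivity) htP) (by omega)
      fun hP => countIn_of_le _ (by omega)
  have hrounds : (t * (2 * deltaL M + 9) : ℝ) ≤ Real.logb 2 P.length * (23 * logStar M) := by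
    have hκ : 2 * deltaL M + 9 ≤ 23 * logStar M := by simp only [deltaL]; omega
    have htlog := natCast_le_logb_of_two_pow_le htP
    exact mul_le_mul htlog (by exact_mod_cast hκ) (by positivity) (t.cast_nonneg.trans htlog)
  have hcount' : ((G.inducedSubtree e i (l ++ X ++ r)).ncard : ℝ) ≤
      8 * (t * (2 * deltaL M + 9) + 2 * D + 2 * (G.level e + 1)) := by
    exact_mod_cast (hcount.trans (Nat.mul_le_mul_left 8 (Nat.add_le_add_right hsum _))).trans
      (by omega)
  push_cast at hD
  linarith [(Nat.cast_nonneg D).trans hD]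

end State

end SigEnc.RLSLP

theorem mainTheorem5_general :
    ∃ C : ℝ, 0 < C ∧
      ∀ (α : Type*) (M : ℕ) (f : (Fin (SigEnc.logStar M + 11) → ℕ) → Bool)
        (T : List α) (G : SigEnc.RLSLP α),
        SigEnc.IsLocallyConsistent M f → G.IsSignatureEncoding M f T →
        ∀ e ∈ G.vars, ∀ u P v : List α, P ≠ [] → G.val e = u ++ P ++ v →
          ∃ U : List ℕ, G.uniq f P = some U ∧ G.Represents e u.length P U ∧
            (G.inducedSubtree e u.length U).Finite ∧
            (∀ t : ℕ, ((G.inducedSubtree e u.length U ∩ G.levelNodes e t).ncard : ℝ) ≤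
              C * SigEnc.logStar M) ∧
            (2 ≤ (G.val e).length →
              ((G.inducedSubtree e u.length U).ncard : ℝ) ≤
                C * (Real.logb 2 (G.val e).length +
                  Real.logb 2 P.length * SigEnc.logStar M)) := by
  refine ⟨1000, by norm_num, fun α M f T G hf ⟨hM, H, hH, _⟩ e he u P v hP hval => ?_⟩
  obtain ⟨ρ, l, X, r, hρ, hle, hX, hs⟩ :=
    SigEnc.RLSLP.exists_state_of_val_eq hf hM hH he hP hval
  have hstart : G.HasRank (4 * H + 1) G.start :=
    SigEnc.RLSLP.hasRank_of_pow hH _ (by simp)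
  exact ⟨l ++ X ++ r, hs.isPartialUniq.uniq_eq, hs.represents hρ hstart hval,
    hs.finite_inducedSubtree hρ hstart,
    fun t => by exact_mod_cast hs.ncard_levelNodes_le hρ hM hH hle hX t,
    hs.ncard_inducedSubtree_le hρ hM hH hle hX⟩

theorem mainTheorem5 :
    ∃ C : ℝ, 0 < C ∧
      ∀ (α : Type*) (M : ℕ) (f : (Fin (SigEnc.logStar M + 11) → ℕ) → Bool)
        (T : List α) (G : SigEnc.RLSLP α),
        SigEnc.IsLocallyConsistent M f → T ≠ [] → 4 * T.length ≤ M →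
        G.IsSignatureEncoding M f T →
        ∀ e ∈ G.vars, ∀ u P v : List α, P ≠ [] → G.val e = u ++ P ++ v →
          ∃ U : List ℕ, G.uniq f P = some U ∧ G.Represents e u.length P U ∧
            (G.inducedSubtree e u.length U).Finite ∧
            (∀ t : ℕ, ((G.inducedSubtree e u.length U ∩ G.levelNodes e t).ncard : ℝ) ≤
              C * SigEnc.logStar M) ∧
            (2 ≤ (G.val e).length →
              ((G.inducedSubtree e u.length U).ncard : ℝ) ≤
                C * (Real.logb 2 (G.val e).length +
                  Real.logb 2 P.length * SigEnc.logStar M)) := by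
  obtain ⟨C, hC, h⟩ := mainTheorem5_general
  exact ⟨C, hC, fun α M f T G hf _ _ hG => h α M f T G hf hG⟩
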